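/- Let $m\ge 1$ and let $\mathcal{C}l_m$ be the complex Clifford algebra generated by $e_1,\dots,e_m$ with $e_ie_j+e_je_i=-2\delta_{ij}$. For $x\in\mathbb{R}^m$ put $\underline{x}=\sum_j x_je_j$, and let $\partial_{\underline{x}}=\sum_j e_j\partial_{x_j}$ be the Dirac operator, both acting by left multiplication on $\mathcal{S}(\mathbb{R}^m)\otimes\mathcal{C}l_m$, the space of $\mathcal{C}l_m$-valued Schwartz functions. Let $u\mapsto\overline{u}$ be the linear anti-involution of $\mathcal{C}l_m$ with $\overline{e_j}=-e_j$, let $u\mapsto u^c$ be complex conjugation of the coefficients in the basis of products $e_{i_1}\cdots e_{i_k}$ $(i_1<\dots<i_k)$, let $[u]_0$ be the scalar part of $u$, and put $$\langle f,g\rangle=\Big[\int_{\mathbb{R}^m}\overline{f^c}\,g\,dx\Big]_0,\qquad \|f\|_2=\langle f,f\rangle^{1/2}.$$ Let $\mathcal{M}_k$ be the space of spherical monogenics of degree $k\ge 0$, i.e. of $\mathcal{C}l_m$-valued homogeneous polynomials $M$ of degree $k$ on $\mathbb{R}^m$ with $\partial_{\underline{x}}M=0$, and let $\{M_k^{(\ell)}\}_\ell$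 be a basis of $\mathcal{M}_k$ over $\mathbb{C}$. With the generalized Laguerre polynomials $L_p^{\alpha}(t)=\sum_{n=0}^p\frac{\Gamma(p+\alpha+1)}{n!\,(p-n)!\,\Gamma(n+\alpha+1)}(-t)^n$, put for $p,k\ge 0$ $$\psi_{2p,k,\ell}(x)=2^pp!\,L_p^{\frac m2+k-1}(|x|^2)\,M_k^{(\ell)}(x)\,e^{-|x|^2/2},\qquad \psi_{2p+1,k,\ell}(x)=2^pp!\sqrt2\,L_p^{\frac m2+k}(|x|^2)\,\underline{x}\,M_k^{(\ell)}(x)\,e^{-|x|^2/2}.$$ Let $T$ be a continuous linear operator on $\mathcal{S}(\mathbb{R}^m)\otimes\mathcal{C}l_m$ that is an integral transform $$(Tf)(y)=\int_{\mathbb{R}^m}K(x,y)f(x)\,dx$$ with a $\mathcal{C}l_m$-valued kernel $K$ (the integral converging absolutely for all $f$ and $y$), and that satisfies (I) the Clifford-Helmholtz relations $T\circ\partial_{\underline{x}}=-i\,\underline{y}\circ T$ and $T\circ\underline{x}=-i\,\partial_{\underline{y}}\circ T$; (II) $T\psi_{j,k,\ell}=\mu_{j,k}\,\psi_{j,k,\ell}$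 for all $j,k,\ell$, with some $\mu_{j,k}\in\mathbb{C}$; (III) $T^4=\mathrm{id}$. Then for every $f\in\mathcal{S}(\mathbb{R}^m)\otimes\mathcal{C}l_m$ $$\|\underline{x}f\|_2\cdot\|\underline{x}\,T(f)\|_2\ \ge\ \frac m2\,\|f\|_2^2 .$$ -/

import Mathlib

noncomputable section

namespace CliffordFourier

/-! ### The complex Clifford algebra with its standard basis -/

/-- The complex Clifford algebra on generators `e₁, …, eₘ` with `eⱼ² = -1` and
`eᵢ eⱼ = -eⱼ eᵢ`, modelled by coordinates in the basis of ordered products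
`e_A = e_{i₁} ⋯ e_{iₖ}`, `A = {i₁ < ⋯ < iₖ}`. The product is defined below, and
`cliffordEquiv` proves that this is Mathlib's `CliffordAlgebra`. The norm is the Euclidean norm of
the coordinates. -/
def Cl (m : ℕ) : Type := EuclideanSpace ℂ (Finset (Fin m))

namespace Cl

variable {m : ℕ}

instance : NormedAddCommGroup (Cl m) :=
  inferInstanceAs (NormedAddCommGroup (EuclideanSpace ℂ (Finset (Fin m))))

instance : InnerProductSpace ℂ (Cl m) :=
  inferInstanceAs (InnerProductSpace ℂ (EuclideanSpace ℂ (Finset (Fin m))))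

instance : FiniteDimensional ℂ (Cl m) :=
  inferInstanceAs (FiniteDimensional ℂ (EuclideanSpace ℂ (Finset (Fin m))))

/-- The coordinate of `u` along the basis element `e_A`. -/
def coord (A : Finset (Fin m)) : Cl m →ₗ[ℂ] ℂ where
  toFun u := (show EuclideanSpace ℂ (Finset (Fin m)) from u) A
  map_add' _ _ := rfl
  map_smul' _ _ := rfl

/-- The element with prescribed coordinates. -/
def ofCoord (c : Finset (Fin m) → ℂ) : Cl m :=
  (WithLp.toLp 2 c : EuclideanSpace ℂ (Finset (Fin m)))

@[simp] theorem coord_ofCoord (c : Finset (Fin m) → ℂ) (A : Finset (Fin m)) :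
    coord A (ofCoord c) = c A := rfl

theorem ext_coord {u v : Cl m} (h : ∀ A, coord A u = coord A v) : u = v :=
  PiLp.ext (p := 2) (α := fun _ : Finset (Fin m) => ℂ) h

/-- The sign in `e_A e_B = sgn A B • e_{A ∆ B}`: one factor `-1` for each pair `a ∈ A`, `b ∈ B`
with `b < a` (anticommutation) or `b = a` (`e_a² = -1`). -/
def sgn (A B : Finset (Fin m)) : ℤ := ∏ a ∈ A, ∏ b ∈ B, if b ≤ a then -1 else 1

theorem prod_symmDiff {f : Fin m → ℤ} (hf : ∀ a, f a * f a = 1) (A B : Finset (Fin m)) :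
    ∏ a ∈ symmDiff A B, f a = (∏ a ∈ A, f a) * ∏ a ∈ B, f a := by
  have key : ∀ S : Finset (Fin m), ∏ a ∈ S, f a = ∏ a, if a ∈ S then f a else 1 := by
    intro S; simp [Finset.prod_ite_mem]
  rw [key, key A, key B, ← Finset.prod_mul_distrib]
  refine Finset.prod_congr rfl fun a _ => ?_
  by_cases hA : a ∈ A <;> by_cases hB : a ∈ B <;> simp [Finset.mem_symmDiff, hA, hB, hf]

theorem sgn_symmDiff_left (A B C : Finset (Fin m)) :
    sgn (symmDiff A B) C = sgn A C * sgn B C := by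
  refine prod_symmDiff (fun a => ?_) A B
  rw [← Finset.prod_mul_distrib]
  exact Finset.prod_eq_one fun b _ => by split_ifs <;> norm_num

theorem sgn_symmDiff_right (A B C : Finset (Fin m)) :
    sgn A (symmDiff B C) = sgn A B * sgn A C := by
  unfold sgn
  rw [← Finset.prod_mul_distrib]
  exact Finset.prod_congr rfl fun a _ =>
    prod_symmDiff (fun b => by split_ifs <;> norm_num) B C

theorem sgn_mul_self (A B : Finset (Fin m)) : sgn A B * sgn A B = 1 := by
  rw [← sgn_symmDiff_left, symmDiff_self]; simp [sgn]

instance : Mul (Cl m) :=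
  ⟨fun u v => ofCoord fun C =>
    ∑ A, (sgn A (symmDiff A C) : ℂ) * coord A u * coord (symmDiff A C) v⟩

instance : One (Cl m) := ⟨ofCoord fun C => if C = ∅ then 1 else 0⟩

theorem coord_mul (u v : Cl m) (C : Finset (Fin m)) :
    coord C (u * v) =
      ∑ A, (sgn A (symmDiff A C) : ℂ) * coord A u * coord (symmDiff A C) v := rfl

theorem coord_one (C : Finset (Fin m)) : coord C (1 : Cl m) = if C = ∅ then 1 else 0 := rfl

/-- Substitution `B = A ∆ C` in sums over subsets. -/
theorem sum_symmDiff (A : Finset (Fin m)) (F : Finset (Fin m) → ℂ) :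
    ∑ B, F (symmDiff A B) = ∑ B, F B :=
  Fintype.sum_equiv ⟨symmDiff A, symmDiff A, symmDiff_symmDiff_cancel_left A,
    symmDiff_symmDiff_cancel_left A⟩ _ _ fun _ => rfl

instance : Ring (Cl m) :=
  { (inferInstance : AddCommGroup (Cl m)) with
    mul := (· * ·)
    one := 1
    left_distrib := fun u v w => ext_coord fun C => by
      simp [coord_mul, mul_add, Finset.sum_add_distrib]
    right_distrib := fun u v w => ext_coord fun C => by
      simp [coord_mul, mul_add, add_mul, Finset.sum_add_distrib]
    zero_mul := fun u => ext_coord fun C => by simp [coord_mul]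
    mul_zero := fun u => ext_coord fun C => by simp [coord_mul]
    one_mul := fun u => ext_coord fun C => by
      have h : symmDiff (∅ : Finset (Fin m)) C = C := bot_symmDiff C
      simp [coord_mul, coord_one, h, sgn]
    mul_one := fun u => ext_coord fun C => by
      rw [coord_mul, Finset.sum_eq_single C]
      · simp [coord_one, sgn]
      · intro A _ hA
        have : symmDiff A C ≠ ∅ := fun h => hA (symmDiff_eq_bot.mp h)
        simp [coord_one, this]
      · simp
    mul_assoc := fun u v w => ext_coord fun D => by
      simp only [coord_mul, Finset.mul_sum, Finset.sum_mul]
      rw [Finset.sum_comm]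
      refine Finset.sum_congr rfl fun A _ => ?_
      rw [← sum_symmDiff A]
      refine Finset.sum_congr rfl fun C _ => ?_
      rw [symmDiff_symmDiff_cancel_left, ← symmDiff_assoc C A D, symmDiff_comm C A]
      simp only [sgn_symmDiff_left, sgn_symmDiff_right, Int.cast_mul]
      have h2 : ((sgn A C : ℤ) : ℂ) * (sgn A C : ℤ) = 1 := by exact_mod_cast sgn_mul_self A C
      linear_combination
        ((sgn A A : ℂ) * sgn C A * sgn C C * sgn A D * sgn C D * coord A u * coord C v *
          coord (symmDiff (symmDiff A C) D) w) * h2 }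

theorem smul_mul' (c : ℂ) (u v : Cl m) : c • u * v = c • (u * v) := ext_coord fun C => by
  simp only [coord_mul, map_smul, smul_eq_mul, Finset.mul_sum]
  exact Finset.sum_congr rfl fun A _ => by ring

theorem mul_smul' (c : ℂ) (u v : Cl m) : u * c • v = c • (u * v) := ext_coord fun C => by
  simp only [coord_mul, map_smul, smul_eq_mul, Finset.mul_sum]
  exact Finset.sum_congr rfl fun A _ => by ring

instance : Algebra ℂ (Cl m) := Algebra.ofModule smul_mul' mul_smul'

/-- The basis element `e_A`. -/
def blade (A : Finset (Fin m)) : Cl m := ofCoord fun C => if C = A then 1 else 0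

theorem coord_blade (A C : Finset (Fin m)) : coord C (blade A) = if C = A then 1 else 0 := rfl

theorem eq_sum_blade (u : Cl m) : u = ∑ A, coord A u • blade A := ext_coord fun C => by
  simp [coord_blade]

theorem blade_mul_blade (A B : Finset (Fin m)) :
    blade A * blade B = (sgn A B : ℂ) • blade (symmDiff A B) := ext_coord fun C => by
  rw [coord_mul, Finset.sum_eq_single A]
  · by_cases h : C = symmDiff A B
    · subst h; simp [coord_blade]
    · have : symmDiff A C ≠ B := fun h' => h (by rw [← h', symmDiff_symmDiff_cancel_left])
      simp [coord_blade, h, this]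
  · intro D _ hD; simp [coord_blade, hD]
  · simp

theorem blade_empty : blade (∅ : Finset (Fin m)) = 1 := rfl

/-- The generator `eⱼ`. -/
def e (j : Fin m) : Cl m := blade {j}

theorem e_mul_self (j : Fin m) : e j * e j = -1 := by
  have : symmDiff {j} {j} = (∅ : Finset (Fin m)) := symmDiff_self _
  rw [e, blade_mul_blade, this, blade_empty]; simp [sgn]

theorem e_mul_e_add (i j : Fin m) (h : i ≠ j) : e i * e j + e j * e i = 0 := by
  rw [e, e, blade_mul_blade, blade_mul_blade, symmDiff_comm ({j} : Finset (Fin m)) {i}, ← add_smul]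
  rcases lt_or_gt_of_ne h with h | h <;> simp [sgn, h.le, h.not_ge]

/-- The vector `∑ zⱼ eⱼ`. -/
def vec : (Fin m → ℂ) →ₗ[ℂ] Cl m where
  toFun z := ∑ j, z j • e j
  map_add' z w := by simp [add_smul, Finset.sum_add_distrib]
  map_smul' c z := by simp [mul_smul, Finset.smul_sum]

theorem vec_apply (z : Fin m → ℂ) : vec z = ∑ j, z j • e j := rfl

/-- The quadratic form `z ↦ -∑ zⱼ²`. -/
abbrev Q (m : ℕ) : QuadraticForm ℂ (Fin m → ℂ) :=
  QuadraticMap.weightedSumSquares ℂ fun _ : Fin m => (-1 : ℂ)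

theorem vec_mul_vec (z : Fin m → ℂ) : vec z * vec z = algebraMap ℂ (Cl m) (Q m z) := by
  have h2 : (2 : ℂ) • (vec z * vec z) = (2 : ℂ) • algebraMap ℂ (Cl m) (Q m z) := by
    have e1 : vec z * vec z = ∑ i, ∑ j, (z i * z j) • (e i * e j) := by
      rw [vec_apply, Finset.sum_mul_sum]
      simp [smul_smul, mul_comm]
    have e2 : vec z * vec z = ∑ i, ∑ j, (z i * z j) • (e j * e i) := by
      rw [e1, Finset.sum_comm]
      simp [mul_comm]
    have e3 : (2 : ℂ) • (vec z * vec z) =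
        ∑ i, ∑ j, (z i * z j) • (e i * e j + e j * e i) := by
      rw [two_smul]; nth_rewrite 1 [e1]; rw [e2]
      simp [Finset.sum_add_distrib]
    rw [e3]
    have e4 : ∀ i, ∑ j, (z i * z j) • (e i * e j + e j * e i) = (-(2 * (z i * z i))) • 1 := by
      intro i
      rw [Finset.sum_eq_single i]
      · rw [e_mul_self, ← two_smul ℂ, smul_smul, smul_neg, neg_smul]
        congr 2; ring
      · intro j _ hj; rw [e_mul_e_add i j hj.symm, smul_zero]
      · simp
    simp only [e4, ← Finset.sum_smul, Algebra.algebraMap_eq_smul_one, smul_smul,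
      QuadraticMap.weightedSumSquares_apply, Finset.mul_sum]
    congr 1
    exact Finset.sum_congr rfl fun i _ => by simp
  exact smul_right_injective _ (two_ne_zero (α := ℂ)) h2

/-- The homomorphism from Mathlib's Clifford algebra that sends the `j`-th generator to `eⱼ`. -/
def ofClifford (m : ℕ) : CliffordAlgebra (Q m) →ₐ[ℂ] Cl m :=
  CliffordAlgebra.lift (Q m) ⟨vec, vec_mul_vec⟩

/-- The ordered product of generators in Mathlib's Clifford algebra. -/
def prodι (A : Finset (Fin m)) : CliffordAlgebra (Q m) :=
  ((A.sort (· ≤ ·)).map fun a => CliffordAlgebra.ι (Q m) (Pi.single a 1)).prod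

theorem prodι_insert {a : Fin m} {A : Finset (Fin m)} (h : ∀ b ∈ A, a < b) :
    prodι (insert a A) = CliffordAlgebra.ι (Q m) (Pi.single a 1) * prodι A := by
  rw [prodι, Finset.sort_insert (· ≤ ·) (fun b hb => (h b hb).le) fun ha => (h a ha).false]
  simp [prodι]

theorem symmDiff_singleton_of_notMem {a : Fin m} {A : Finset (Fin m)} (h : a ∉ A) :
    symmDiff {a} A = insert a A := by
  ext b; simp only [Finset.mem_symmDiff, Finset.mem_singleton, Finset.mem_insert]
  by_cases hb : b = a
  · subst hb; simp [h]
  · simp [hb]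

theorem sgn_singleton_of_lt {a : Fin m} {A : Finset (Fin m)} (h : ∀ b ∈ A, a < b) :
    sgn {a} A = 1 := by
  simp only [sgn, Finset.prod_singleton]
  exact Finset.prod_eq_one fun b hb => by simp [h b hb]

theorem ι_mul_prodι (j : Fin m) (A : Finset (Fin m)) :
    CliffordAlgebra.ι (Q m) (Pi.single j 1) * prodι A =
      (sgn {j} A : ℂ) • prodι (symmDiff {j} A) := by
  induction A using Finset.induction_on_min with
  | empty =>
    have h : symmDiff {j} (∅ : Finset (Fin m)) = {j} := symmDiff_bot _
    simp [h, sgn, prodι]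
  | insert a A ha ih =>
    have haA : a ∉ A := fun h => (ha a h).false
    have hsq : CliffordAlgebra.ι (Q m) (Pi.single a 1) * CliffordAlgebra.ι (Q m) (Pi.single a 1)
        = -1 := by
      rw [CliffordAlgebra.ι_sq_scalar, QuadraticMap.weightedSumSquares_apply,
        Finset.sum_eq_single a] <;> simp +contextual
    have hs : ∀ i : Fin m, sgn {i} (insert a A) = (if a ≤ i then -1 else 1) * sgn {i} A := by
      intro i; simp [sgn, Finset.prod_insert haA]
    rcases lt_trichotomy j a with hj | hj | hj
    · have hlt : ∀ b ∈ insert a A, j < b := by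
        intro b hb
        rcases Finset.mem_insert.mp hb with rfl | hb
        · exact hj
        · exact hj.trans (ha b hb)
      rw [sgn_singleton_of_lt hlt, symmDiff_singleton_of_notMem fun h => (hlt j h).false,
        prodι_insert hlt]
      simp
    · subst hj
      have : symmDiff {j} (insert j A) = A := by
        rw [← symmDiff_singleton_of_notMem haA, symmDiff_symmDiff_cancel_left]
      rw [this, hs, sgn_singleton_of_lt ha, prodι_insert ha, ← mul_assoc, hsq]
      simp
    · have hanti : CliffordAlgebra.ι (Q m) (Pi.single j 1) *
          CliffordAlgebra.ι (Q m) (Pi.single a 1) =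
          -(CliffordAlgebra.ι (Q m) (Pi.single a 1) *
            CliffordAlgebra.ι (Q m) (Pi.single j 1)) := by
        apply CliffordAlgebra.ι_mul_ι_comm_of_isOrtho
        rw [QuadraticMap.isOrtho_def]
        simp only [QuadraticMap.weightedSumSquares_apply, Pi.add_apply]
        rw [← Finset.sum_add_distrib]
        refine Finset.sum_congr rfl fun i _ => ?_
        have hja : j ≠ a := hj.ne'
        by_cases h1 : i = j
        · subst h1; simp [hja]
        · simp [h1]
      have hlt : ∀ b ∈ symmDiff {j} A, a < b := by
        intro b hb
        rcases Finset.mem_symmDiff.mp hb with ⟨hb, _⟩ | ⟨hb, _⟩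
        · rw [Finset.mem_singleton.mp hb]; exact hj
        · exact ha b hb
      have hsd : symmDiff {j} (insert a A) = insert a (symmDiff {j} A) := by
        rw [← symmDiff_singleton_of_notMem haA,
          ← symmDiff_singleton_of_notMem fun h => (hlt a h).false, symmDiff_left_comm]
      rw [hsd, prodι_insert hlt, prodι_insert ha, ← mul_assoc, hanti, neg_mul, mul_assoc, ih, hs]
      simp [hj.le]

/-- The linear inverse of `ofClifford`. -/
def toClifford (m : ℕ) : Cl m →ₗ[ℂ] CliffordAlgebra (Q m) :=
  ∑ A, (coord A).smulRight (prodι A)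

theorem toClifford_apply (u : Cl m) : toClifford m u = ∑ A, coord A u • prodι A := by
  simp [toClifford]

theorem toClifford_blade (A : Finset (Fin m)) : toClifford m (blade A) = prodι A := by
  simp [toClifford_apply, coord_blade]

theorem toClifford_vec_mul (z : Fin m → ℂ) (u : Cl m) :
    toClifford m (vec z * u) = CliffordAlgebra.ι (Q m) z * toClifford m u := by
  have hz : z = ∑ j, z j • Pi.single j (1 : ℂ) := by
    ext i; simp [Pi.single_apply]
  have hb : ∀ (j : Fin m) (A : Finset (Fin m)), toClifford m (e j * blade A) =
      CliffordAlgebra.ι (Q m) (Pi.single j 1) * toClifford m (blade A) := by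
    intro j A
    rw [e, blade_mul_blade, map_smul, toClifford_blade, toClifford_blade, ι_mul_prodι]
  have hj : ∀ (j : Fin m), toClifford m (e j * u) =
      CliffordAlgebra.ι (Q m) (Pi.single j 1) * toClifford m u := by
    intro j
    rw [eq_sum_blade u]
    simp only [Finset.mul_sum, map_sum, map_smul, mul_smul_comm, hb]
  conv_rhs => rw [hz]
  simp only [vec_apply, Finset.sum_mul, map_sum, map_smul, smul_mul_assoc, hj]

theorem toClifford_ofClifford (x : CliffordAlgebra (Q m)) :
    toClifford m (ofClifford m x) = x := by
  induction x using CliffordAlgebra.left_induction with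
  | algebraMap r =>
    rw [AlgHom.commutes, Algebra.algebraMap_eq_smul_one, ← blade_empty, map_smul,
      toClifford_blade, Algebra.algebraMap_eq_smul_one]
    simp [prodι]
  | add x y hx hy => rw [map_add, map_add, hx, hy]
  | ι_mul x z hx =>
    have : ofClifford m (CliffordAlgebra.ι (Q m) z) = vec z := CliffordAlgebra.lift_ι_apply ..
    rw [map_mul, this, toClifford_vec_mul, hx]

theorem ofClifford_prodι (A : Finset (Fin m)) : ofClifford m (prodι A) = blade A := by
  induction A using Finset.induction_on_min with
  | empty => simp [prodι, blade_empty]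
  | insert a A ha ih =>
    have haA : a ∉ A := fun h => (ha a h).false
    have : ofClifford m (CliffordAlgebra.ι (Q m) (Pi.single a 1)) = e a := by
      rw [ofClifford, CliffordAlgebra.lift_ι_apply, vec_apply, Finset.sum_eq_single a] <;>
        simp +contextual
    rw [prodι_insert ha, map_mul, ih, this, e, blade_mul_blade, sgn_singleton_of_lt ha,
      symmDiff_singleton_of_notMem haA]
    simp

theorem ofClifford_toClifford (u : Cl m) : ofClifford m (toClifford m u) = u := by
  conv_rhs => rw [eq_sum_blade u]
  simp [toClifford_apply, ofClifford_prodι]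

/-- The coordinate model is Mathlib's Clifford algebra of the quadratic form `-∑ zⱼ²`. -/
def cliffordEquiv (m : ℕ) : CliffordAlgebra (Q m) ≃ₐ[ℂ] Cl m :=
  AlgEquiv.ofBijective (ofClifford m)
    ⟨Function.LeftInverse.injective toClifford_ofClifford,
      Function.RightInverse.surjective ofClifford_toClifford⟩

theorem cliffordEquiv_ι (z : Fin m → ℂ) :
    cliffordEquiv m (CliffordAlgebra.ι (Q m) z) = vec z := CliffordAlgebra.lift_ι_apply ..

/-- The projection `[u]₀` on the scalars. -/
def scalarPart : Cl m →ₗ[ℂ] ℂ := coord ∅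

/-- The map `u ↦ \overline{u^c}`: complex conjugation of the coordinates composed with the
anti-involution that sends `eⱼ` to `-eⱼ`, hence `e_A` to `(-1)^{|A|(|A|+1)/2} e_A`. -/
def hconj (u : Cl m) : Cl m :=
  ofCoord fun A => (-1) ^ (A.card * (A.card + 1) / 2) * starRingEnd ℂ (coord A u)

theorem sgn_self (A : Finset (Fin m)) : sgn A A = (-1) ^ (A.card * (A.card + 1) / 2) := by
  induction A using Finset.induction_on_min with
  | empty => simp [sgn]
  | insert a A ha ih =>
    have haA : a ∉ A := fun h => (ha a h).false
    have h1 : sgn (insert a A) (insert a A) = (-1) ^ (A.card + 1) * sgn A A := by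
      conv_lhs => rw [← symmDiff_singleton_of_notMem haA]
      rw [sgn_symmDiff_left, sgn_symmDiff_right, sgn_symmDiff_right, sgn_singleton_of_lt ha]
      have h2 : sgn A {a} = (-1) ^ A.card := by
        simp only [sgn, Finset.prod_singleton]
        rw [Finset.prod_congr rfl fun b hb => if_pos (ha b hb).le]
        simp
      rw [h2]; simp [sgn, pow_succ]
    have h3 : (A.card + 1) * (A.card + 1 + 1) / 2 = A.card * (A.card + 1) / 2 + (A.card + 1) := by
      rw [show (A.card + 1) * (A.card + 1 + 1) = A.card * (A.card + 1) + 2 * (A.card + 1) by ring]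
      omega
    rw [h1, ih, Finset.card_insert_of_notMem haA, h3]
    ring

theorem coord_hconj (A : Finset (Fin m)) (u : Cl m) :
    coord A (hconj u) = (sgn A A : ℂ) * starRingEnd ℂ (coord A u) := by
  rw [sgn_self]; simp [hconj]

theorem hconj_mul (u v : Cl m) : hconj (u * v) = hconj v * hconj u := ext_coord fun C => by
  simp only [coord_hconj, coord_mul, map_sum, map_mul, map_intCast, Finset.mul_sum]
  rw [← sum_symmDiff C]
  refine Finset.sum_congr rfl fun A _ => ?_
  have h : symmDiff (symmDiff C A) C = A := by
    rw [symmDiff_comm, symmDiff_symmDiff_cancel_left]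
  rw [h, symmDiff_comm A C]
  simp only [sgn_symmDiff_left, sgn_symmDiff_right, Int.cast_mul]
  have h2 : ((sgn A A : ℤ) : ℂ) * (sgn A A : ℤ) = 1 := by exact_mod_cast sgn_mul_self A A
  have h3 : ((sgn A C : ℤ) : ℂ) * (sgn A C : ℤ) = 1 := by exact_mod_cast sgn_mul_self A C
  linear_combination (-(sgn A A : ℂ) * sgn C A * sgn C C * starRingEnd ℂ (coord (symmDiff C A) u)
    * starRingEnd ℂ (coord A v)) * ((sgn A C : ℂ) * sgn A C * h2 + h3)

theorem hconj_e (j : Fin m) : hconj (e j) = -e j := ext_coord fun A => by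
  rw [coord_hconj, map_neg, e, coord_blade]
  split_ifs with h
  · subst h; simp [sgn]
  · simp

/-- `[\overline{u^c} v]₀` is the Hermitian inner product of the coordinates. -/
theorem scalarPart_hconj_mul (u v : Cl m) :
    scalarPart (hconj u * v) = ∑ A, starRingEnd ℂ (coord A u) * coord A v := by
  rw [scalarPart, coord_mul]
  refine Finset.sum_congr rfl fun A _ => ?_
  have h : symmDiff A ∅ = A := symmDiff_bot A
  have h1 : ((sgn A A : ℤ) : ℂ) * (sgn A A : ℤ) = 1 := by exact_mod_cast sgn_mul_self A A
  rw [h, coord_hconj]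
  linear_combination (starRingEnd ℂ (coord A u) * coord A v) * h1

/-- The product as a continuous bilinear map. -/
def mulL (m : ℕ) : Cl m →L[ℂ] Cl m →L[ℂ] Cl m :=
  (LinearMap.mul ℂ (Cl m)).toContinuousBilinearMap

@[simp] theorem mulL_apply (u v : Cl m) : mulL m u v = u * v := rfl

end Cl

open Cl SchwartzMap LineDeriv

/-! ### Clifford-valued Schwartz functions -/

/-- The Euclidean space `ℝᵐ`. -/
abbrev E (m : ℕ) : Type := EuclideanSpace ℝ (Fin m)

variable {m : ℕ}

/-- The vector variable `x = ∑ xⱼ eⱼ`. -/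
def xvec (x : E m) : Cl m := ∑ j, (x j : ℂ) • e j

theorem xvec_mul_self (x : E m) : xvec x * xvec x = -((‖x‖ ^ 2 : ℝ) : ℂ) • 1 := by
  have h := vec_mul_vec fun j => (x j : ℂ)
  rw [vec_apply] at h
  rw [xvec, h, Algebra.algebraMap_eq_smul_one, QuadraticMap.weightedSumSquares_apply,
    EuclideanSpace.norm_sq_eq]
  simp [← sq]

theorem hasTemperateGrowth_coord (j : Fin m) :
    (fun x : E m => (x j : ℂ)).HasTemperateGrowth :=
  (Complex.ofRealCLM.comp (EuclideanSpace.proj j : E m →L[ℝ] ℝ)).hasTemperateGrowth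

theorem hasTemperateGrowth_xvec : (xvec : E m → Cl m).HasTemperateGrowth := by
  unfold xvec
  have := fun j => hasTemperateGrowth_coord (m := m) j
  fun_prop

/-- Multiplication by the vector variable, `f ↦ x f`, on Schwartz functions. -/
def mulX (m : ℕ) : 𝓢(E m, Cl m) →L[ℂ] 𝓢(E m, Cl m) :=
  SchwartzMap.bilinLeftCLM (mulL m).flip hasTemperateGrowth_xvec

theorem mulX_apply (f : 𝓢(E m, Cl m)) (x : E m) : mulX m f x = xvec x * f x := rfl

/-- The Dirac operator `∂ f = ∑ eⱼ ∂f/∂xⱼ` on functions. -/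
def diracFun (f : E m → Cl m) (x : E m) : Cl m :=
  ∑ j, e j * lineDeriv ℝ f x (EuclideanSpace.single j 1)

/-- The Dirac operator on Schwartz functions. -/
def dirac (m : ℕ) : 𝓢(E m, Cl m) →L[ℂ] 𝓢(E m, Cl m) :=
  ∑ j, (SchwartzMap.postcompCLM (mulL m (e j))).comp
    (lineDerivOpCLM ℂ 𝓢(E m, Cl m) (EuclideanSpace.single j (1 : ℝ)))

theorem dirac_apply (f : 𝓢(E m, Cl m)) (x : E m) : dirac m f x = diracFun f x := by
  simp [dirac, diracFun, SchwartzMap.lineDerivOp_apply]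

/-! ### The `L²` norm -/

/-- The inner product `⟨f, g⟩ = [∫ \overline{f^c} g dx]₀`. -/
def innerL2 (f g : E m → Cl m) : ℂ := scalarPart (∫ x, hconj (f x) * g x)

/-- The norm `‖f‖₂ = ⟨f, f⟩^{1/2}`. -/
def normL2 (f : E m → Cl m) : ℝ := √(innerL2 f f).re

/-! ### Spherical monogenics and the eigenfunction basis -/

/-- Clifford-valued homogeneous polynomials of degree `k`. -/
def IsHomogPoly (k : ℕ) (M : E m → Cl m) : Prop :=
  ∀ A, ∃ P : MvPolynomial (Fin m) ℂ, P.IsHomogeneous k ∧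
    ∀ x : E m, coord A (M x) = MvPolynomial.eval (fun j => (x j : ℂ)) P

theorem hasTemperateGrowth_eval (P : MvPolynomial (Fin m) ℂ) :
    (fun x : E m => MvPolynomial.eval (fun j => (x j : ℂ)) P).HasTemperateGrowth := by
  induction P using MvPolynomial.induction_on with
  | C a => simp only [MvPolynomial.eval_C]; exact .const a
  | add p q hp hq => simp only [map_add]; exact hp.add hq
  | mul_X p j hp =>
    simp only [map_mul, MvPolynomial.eval_X]; exact hp.mul (hasTemperateGrowth_coord j)

theorem IsHomogPoly.hasTemperateGrowth {k : ℕ} {M : E m → Cl m} (hM : IsHomogPoly k M) :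
    M.HasTemperateGrowth := by
  have h : M = fun x => ∑ A, coord A (M x) • blade A := funext fun x => eq_sum_blade (M x)
  rw [h]
  refine Function.HasTemperateGrowth.sum fun A _ => ?_
  obtain ⟨P, _, hP⟩ := hM A
  simp only [hP]
  have := hasTemperateGrowth_eval P
  fun_prop

theorem IsHomogPoly.differentiable {k : ℕ} {M : E m → Cl m} (hM : IsHomogPoly k M) :
    Differentiable ℝ M := hM.hasTemperateGrowth.1.differentiable (by simp)

/-- The space `𝓜ₖ` of spherical monogenics of degree `k`: Clifford-valued homogeneous polynomials
of degree `k` that are null-solutions of the Dirac operator. -/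
def sphericalMonogenics (m k : ℕ) : Submodule ℂ (E m → Cl m) where
  carrier := {M | IsHomogPoly k M ∧ ∀ x, diracFun M x = 0}
  zero_mem' := by
    refine ⟨fun A => ⟨0, MvPolynomial.isHomogeneous_zero _ _ _, by simp⟩, fun x => ?_⟩
    have : ∀ v, lineDeriv ℝ (0 : E m → Cl m) x v = 0 := fun v => by simp [lineDeriv]
    simp [diracFun, this]
  add_mem' := by
    rintro M N ⟨hM, hM'⟩ ⟨hN, hN'⟩
    refine ⟨fun A => ?_, fun x => ?_⟩
    · obtain ⟨P, hP, hP'⟩ := hM A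
      obtain ⟨R, hR, hR'⟩ := hN A
      exact ⟨P + R, hP.add hR, fun x => by simp [hP', hR']⟩
    · have h : ∀ v, lineDeriv ℝ (M + N) x v = lineDeriv ℝ M x v + lineDeriv ℝ N x v := fun v => by
        have h1 := hM.differentiable x
        have h2 := hN.differentiable x
        rw [(h1.add h2).lineDeriv_eq_fderiv, h1.lineDeriv_eq_fderiv, h2.lineDeriv_eq_fderiv,
          fderiv_add h1 h2]
        rfl
      have := congrArg₂ (· + ·) (hM' x) (hN' x)
      simpa [diracFun, h, mul_add, Finset.sum_add_distrib] using this
  smul_mem' := by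
    rintro c M ⟨hM, hM'⟩
    refine ⟨fun A => ?_, fun x => ?_⟩
    · obtain ⟨P, hP, hP'⟩ := hM A
      exact ⟨MvPolynomial.C c * P, by simpa using (MvPolynomial.isHomogeneous_C _ c).mul hP,
        fun x => by simp [hP']⟩
    · have h : ∀ v, lineDeriv ℝ (c • M) x v = c • lineDeriv ℝ M x v := fun v => by
        rw [lineDeriv, lineDeriv]
        exact deriv_const_smul_field ..
      have := congrArg (c • ·) (hM' x)
      simpa [diracFun, h, Finset.smul_sum] using this

/-- The generalized Laguerre polynomial
`L_j^α(t) = ∑_{n ≤ j} Γ(j+α+1) / (n! (j-n)! Γ(n+α+1)) (-t)^n`. -/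
def laguerre (j : ℕ) (α t : ℝ) : ℝ :=
  ∑ n ∈ Finset.range (j + 1),
    Real.Gamma (j + α + 1) / (n.factorial * (j - n).factorial * Real.Gamma (n + α + 1)) * (-t) ^ n

theorem hasTemperateGrowth_laguerre (j : ℕ) (α : ℝ) :
    (fun x : E m => laguerre j α (‖x‖ ^ 2)).HasTemperateGrowth := by
  have := Function.hasTemperateGrowth_norm_sq (E m)
  unfold laguerre
  fun_prop

/-- The Gaussian `e^{-|x|²/2}` as a Schwartz function. -/
def gaussian (m : ℕ) : 𝓢(E m, ℝ) where
  toFun x := Real.exp (-‖x‖ ^ 2 / 2)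
  smooth' := Real.contDiff_exp.comp (((contDiff_norm_sq ℝ).neg).div_const 2)
  decay' := fun k n => by
    have hg : (fun x : E m => -‖x‖ ^ 2 / 2).HasTemperateGrowth := by
      have := Function.hasTemperateGrowth_norm_sq (E m)
      have h : (fun x : E m => (-1 / 2 : ℝ) * ‖x‖ ^ 2).HasTemperateGrowth := by fun_prop
      convert h using 2
      ring
    obtain ⟨l, C, hC, hl⟩ := hg.norm_iteratedFDeriv_le_uniform n
    obtain ⟨B, hB⟩ : ∃ B : ℝ, ∀ s : ℝ, 0 ≤ s →
        (1 + s) ^ (k + l * n) * Real.exp (-s ^ 2 / 2) ≤ B := by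
      refine ⟨(k + l * n).factorial * Real.exp 2, fun s hs => ?_⟩
      have h1 : (1 + s) ^ (k + l * n) / (k + l * n).factorial ≤ Real.exp (1 + s) :=
        Real.pow_div_factorial_le_exp (1 + s) (by linarith) _
      rw [div_le_iff₀ (by positivity)] at h1
      calc (1 + s) ^ (k + l * n) * Real.exp (-s ^ 2 / 2)
          ≤ Real.exp (1 + s) * (k + l * n).factorial * Real.exp (-s ^ 2 / 2) := by gcongr
        _ = (k + l * n).factorial * Real.exp (1 + s + -s ^ 2 / 2) := by
          rw [Real.exp_add (1 + s)]; ring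
        _ ≤ (k + l * n).factorial * Real.exp 2 := by
          gcongr
          nlinarith [sq_nonneg (s - 1)]
    refine ⟨n.factorial * (1 + C) ^ n * B, fun x => ?_⟩
    have hx : 0 ≤ ‖x‖ := norm_nonneg x
    have h := norm_iteratedFDeriv_comp_le (𝕜 := ℝ) (n := n) (N := (⊤ : ℕ∞))
      Real.contDiff_exp hg.1 (by exact_mod_cast le_top) x
      (C := Real.exp (-‖x‖ ^ 2 / 2)) (D := (1 + C) * (1 + ‖x‖) ^ l)
      (fun i _ => by
        rw [norm_iteratedFDeriv_eq_norm_iteratedDeriv, iteratedDeriv_eq_iterate,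
          Real.iter_deriv_exp, Real.norm_eq_abs, abs_of_pos (Real.exp_pos _)])
      (fun i hi hin => by
        have h1 : 1 ≤ (1 + C) * (1 + ‖x‖) ^ l :=
          one_le_mul_of_one_le_of_one_le (by linarith) (one_le_pow₀ (by linarith))
        calc _ ≤ C * (1 + ‖x‖) ^ l := hl i hin x
          _ ≤ (1 + C) * (1 + ‖x‖) ^ l := by gcongr; linarith
          _ ≤ _ := le_self_pow₀ h1 (by omega))
    calc ‖x‖ ^ k * ‖iteratedFDeriv ℝ n (fun x : E m => Real.exp (-‖x‖ ^ 2 / 2)) x‖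
        ≤ (1 + ‖x‖) ^ k * (n.factorial * Real.exp (-‖x‖ ^ 2 / 2) *
            ((1 + C) * (1 + ‖x‖) ^ l) ^ n) := by
          gcongr
          · linarith
          · exact h
      _ = n.factorial * (1 + C) ^ n *
            ((1 + ‖x‖) ^ (k + l * n) * Real.exp (-‖x‖ ^ 2 / 2)) := by
          rw [mul_pow, ← pow_mul, pow_add]; ring
      _ ≤ _ := by gcongr; exact hB _ hx

/-- The factor of `e^{-|x|²/2}` in `psi`. -/
def psiPoly (j k : ℕ) (M : E m → Cl m) (x : E m) : Cl m :=
  if Even j then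
    (2 ^ (j / 2) * (j / 2).factorial * laguerre (j / 2) (m / 2 + k - 1) (‖x‖ ^ 2)) • M x
  else
    (2 ^ (j / 2) * (j / 2).factorial * √2 * laguerre (j / 2) (m / 2 + k) (‖x‖ ^ 2)) •
      (xvec x * M x)

theorem hasTemperateGrowth_psiPoly (j : ℕ) {k : ℕ} {M : E m → Cl m} (hM : IsHomogPoly k M) :
    (psiPoly j k M).HasTemperateGrowth := by
  have h1 := hM.hasTemperateGrowth
  have h2 : (fun x : E m => xvec x * M x).HasTemperateGrowth :=
    (mulL m).bilinear_hasTemperateGrowth hasTemperateGrowth_xvec h1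
  have h3 := fun α => hasTemperateGrowth_laguerre (m := m) (j / 2) α
  unfold psiPoly
  split_ifs
  · have := h3 (m / 2 + k - 1)
    fun_prop
  · have := h3 (m / 2 + k)
    fun_prop

/-- The functions `ψ_{j,k}` generated by a spherical monogenic `M` of degree `k`:
`ψ_{2p,k} = 2^p p! L_p^{m/2+k-1}(|x|²) M e^{-|x|²/2}` and
`ψ_{2p+1,k} = 2^p p! √2 L_p^{m/2+k}(|x|²) x M e^{-|x|²/2}`; the next two theorems spell this
out. -/
def psi (j k : ℕ) (M : sphericalMonogenics m k) : 𝓢(E m, Cl m) :=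
  SchwartzMap.bilinLeftCLM (ContinuousLinearMap.lsmul ℝ ℝ)
    (hasTemperateGrowth_psiPoly j M.2.1) (gaussian m)

theorem psi_apply_even (p k : ℕ) (M : sphericalMonogenics m k) (x : E m) :
    psi (2 * p) k M x = (2 ^ p * p.factorial * laguerre p (m / 2 + k - 1) (‖x‖ ^ 2) *
      Real.exp (-‖x‖ ^ 2 / 2)) • (M : E m → Cl m) x := by
  have h : psi (2 * p) k M x = Real.exp (-‖x‖ ^ 2 / 2) • psiPoly (2 * p) k M x := rfl
  rw [h, psiPoly, if_pos (even_two_mul p), smul_smul, Nat.mul_div_cancel_left p two_pos,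
    mul_comm (Real.exp _)]

theorem psi_apply_odd (p k : ℕ) (M : sphericalMonogenics m k) (x : E m) :
    psi (2 * p + 1) k M x = (2 ^ p * p.factorial * √2 * laguerre p (m / 2 + k) (‖x‖ ^ 2) *
      Real.exp (-‖x‖ ^ 2 / 2)) • (xvec x * (M : E m → Cl m) x) := by
  have h : psi (2 * p + 1) k M x = Real.exp (-‖x‖ ^ 2 / 2) • psiPoly (2 * p + 1) k M x := rfl
  have h2 : (2 * p + 1) / 2 = p := by omega
  rw [h, psiPoly, if_neg (by simp), smul_smul, h2, mul_comm (Real.exp _)]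

end CliffordFourier

end

open CliffordFourier
open scoped SchwartzMap

/-! Write `x` for the vector variable and `∂` for the Dirac operator. The first Helmholtz relation
gives `‖x T f‖ = ‖T ∂f‖`. If `T` is an `L²` contraction, then `T⁴ = id` yields `‖∂f‖ = ‖T⁴ ∂f‖ ≤ ‖T
∂f‖`, and the claim reduces to Heisenberg's inequality `‖x f‖ ‖∂f‖ ≥ (m/2) ‖f‖²`
(`heisenberg_dirac`). That inequality is the scalar one summed over coordinates, since `x² = -|x|²`
and `∂² = -Δ`.

Contractivity is first proved on polynomials times the Gaussian, where `T` preserves inner products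
(`inner_map_map_of_mem_gaussSpan`). The operators `∂ - x` and `x + ∂` are adjoint, and `T` commutes
with them up to the phases `i` and `-i`. A polynomial times the Gaussian therefore splits
orthogonally into a part in the image of `∂ - x`, handled by induction on the degree, and a part
killed by `x + ∂`. Since `(x + ∂)(P e^{-|x|²/2}) = (∂P) e^{-|x|²/2}`, the second part is a sum of
spherical monogenics times the Gaussian. These are the `ψ_{0,k}`, on which `T` acts by `μ_{0,k}`,
and `T⁴ = id` makes this scalar a fourth root of unity whenever `𝓜ₖ ≠ 0`.

The passage to all Schwartz functions is not immediate, because `T` is continuous only for the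
Schwartz topology. With `H = -Δ + |x|²`, a Sobolev argument gives `‖T f‖ ≤ C ‖H^N f‖` for some `N`
(`hermiteBounded_norm_continuous`). Polynomials times the Gaussian are `L²`-dense
(`exists_gaussSpan_norm_sub_lt`), and `H` maps each degree-bounded space of them onto itself
(`exists_hermite_pow_eq`). Hence `H^N f` can be approximated in `L²` by some `H^N g`, and both `f -
g` and `T (f - g)` are then small (`norm_map_le_of_forall_gaussSpan`). -/

noncomputable section

namespace CliffordFourier

open Cl SchwartzMap LineDeriv MeasureTheory
open scoped InnerProductSpace FourierTransform

/-! ### Coordinates, derivatives, and the harmonic oscillator in `L²` -/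

section Oscillator

variable {m : ℕ} {F : Type*} [NormedAddCommGroup F] [InnerProductSpace ℂ F]

/-- Multiplication of Schwartz functions by the `j`-th coordinate. -/
def coordMul (j : Fin m) : Module.End ℂ 𝓢(E m, F) :=
  (smulLeftCLM F fun x : E m => (x j : ℂ)).toLinearMap

/-- The partial derivative in the `j`-th coordinate on Schwartz functions. -/
def partialD (j : Fin m) : Module.End ℂ 𝓢(E m, F) :=
  (lineDerivOpCLM ℂ 𝓢(E m, F) (EuclideanSpace.single j (1 : ℝ))).toLinearMap

theorem coordMul_apply (j : Fin m) (f : 𝓢(E m, F)) (x : E m) :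
    coordMul j f x = (x j : ℂ) • f x :=
  smulLeftCLM_apply_apply (hasTemperateGrowth_coord j) f x

theorem partialD_apply (j : Fin m) (f : 𝓢(E m, F)) (x : E m) :
    partialD j f x = fderiv ℝ f x (EuclideanSpace.single j 1) := rfl

theorem partialD_eq (j : Fin m) (f : 𝓢(E m, F)) :
    partialD j f = ∂_{(EuclideanSpace.single j (1 : ℝ) : E m)} f := rfl

theorem coordMul_comm (i j : Fin m) (f : 𝓢(E m, F)) :
    coordMul i (coordMul j f) = coordMul j (coordMul i f) := by
  ext x
  simp only [coordMul_apply, smul_smul, mul_comm]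

theorem partialD_comm (i j : Fin m) (f : 𝓢(E m, F)) :
    partialD i (partialD j f) = partialD j (partialD i f) := by
  ext x
  have h : ∀ v w : E m, ∂_{v} (∂_{w} f) x = iteratedFDeriv ℝ 2 f x ![v, w] := by
    intro v w
    rw [← iteratedLineDerivOp_eq_iteratedFDeriv]
    simp [iteratedLineDerivOp_succ_left]
  simp only [partialD_eq, h]
  have hs : ContDiffAt ℝ 2 f x := f.contDiffAt 2
  have := hs.isSymmSndFDerivAt (by simp)
  simpa [iteratedFDeriv_two_apply] using this _ _

theorem partialD_coordMul (i j : Fin m) (f : 𝓢(E m, F)) :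
    partialD i (coordMul j f) = coordMul j (partialD i f) + if i = j then f else 0 := by
  ext x
  have h1 : HasFDerivAt (fun y : E m => (y j : ℂ))
      (Complex.ofRealCLM.comp (EuclideanSpace.proj j : E m →L[ℝ] ℝ)) x :=
    (Complex.ofRealCLM.comp (EuclideanSpace.proj j : E m →L[ℝ] ℝ)).hasFDerivAt
  have h2 := h1.smul (f.hasFDerivAt x)
  have h3 : (coordMul j f : E m → F) = fun y : E m => (y j : ℂ) • f y :=
    funext fun y => coordMul_apply j f y
  rw [partialD_apply, h3]
  erw [h2.fderiv]
  simp only [_root_.add_apply, coordMul_apply, partialD_apply]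
  by_cases h : i = j
  · subst h; simp
  · simp [h, Ne.symm h]

/-- The embedding of Schwartz functions in `L²`. -/
def toL2 (m : ℕ) (F : Type*) [NormedAddCommGroup F] [InnerProductSpace ℂ F] :
    𝓢(E m, F) →L[ℂ] Lp F 2 (volume : Measure (E m)) :=
  toLpCLM ℂ F 2 volume

theorem inner_toL2 (f g : 𝓢(E m, F)) : ⟪toL2 m F f, toL2 m F g⟫_ℂ = ∫ x, ⟪f x, g x⟫_ℂ :=
  inner_toL2_toL2_eq f g volume

theorem toL2_injective : Function.Injective (toL2 m F) := injective_toLp 2 volume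

theorem inner_coordMul (j : Fin m) (f g : 𝓢(E m, F)) :
    ⟪toL2 m F (coordMul j f), toL2 m F g⟫_ℂ = ⟪toL2 m F f, toL2 m F (coordMul j g)⟫_ℂ := by
  simp [inner_toL2, coordMul_apply]

theorem inner_partialD (j : Fin m) (f g : 𝓢(E m, F)) :
    ⟪toL2 m F (partialD j f), toL2 m F g⟫_ℂ = -⟪toL2 m F f, toL2 m F (partialD j g)⟫_ℂ := by
  have := integral_bilinear_lineDerivOp_right_eq_neg_left (μ := volume) f g
    (isBoundedBilinearMap_inner (𝕜 := ℂ) (E := F)).toContinuousLinearMap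
    (EuclideanSpace.single j (1 : ℝ))
  rw [inner_toL2, inner_toL2]
  exact (neg_eq_iff_eq_neg.mpr this).symm

/-- The Hamiltonian of the harmonic oscillator, `-Δ + |x|²`. -/
def hermite (m : ℕ) (F : Type*) [NormedAddCommGroup F] [InnerProductSpace ℂ F] :
    Module.End ℂ 𝓢(E m, F) :=
  ∑ j, (coordMul j * coordMul j - partialD j * partialD j)

theorem inner_hermite_left (f g : 𝓢(E m, F)) :
    ⟪toL2 m F (hermite m F f), toL2 m F g⟫_ℂ = ⟪toL2 m F f, toL2 m F (hermite m F g)⟫_ℂ := by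
  simp [hermite, sum_inner, inner_sum, inner_sub_left, inner_sub_right, inner_coordMul,
    inner_partialD]

theorem inner_hermite_self (f : 𝓢(E m, F)) :
    ⟪toL2 m F f, toL2 m F (hermite m F f)⟫_ℂ =
      ((∑ j, (‖toL2 m F (coordMul j f)‖ ^ 2 + ‖toL2 m F (partialD j f)‖ ^ 2) : ℝ) : ℂ) := by
  simp only [hermite, LinearMap.sum_apply, LinearMap.sub_apply, Module.End.mul_apply, map_sum,
    map_sub, inner_sum, inner_sub_right]
  push_cast
  refine Finset.sum_congr rfl fun j _ => ?_
  rw [← inner_coordMul, ← neg_eq_iff_eq_neg.mpr (inner_partialD j f (partialD j f)),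
    inner_self_eq_norm_sq_to_K, inner_self_eq_norm_sq_to_K]
  simp

/-- The commutator `[∂_j, x_j] = 1`, paired with `f`, writes `‖f‖²` as two inner products of `x_j f`
and `∂_j f`; Cauchy–Schwarz bounds each. -/
theorem norm_sq_le_coordMul_partialD (j : Fin m) (f : 𝓢(E m, F)) :
    ‖toL2 m F f‖ ^ 2 ≤ 2 * (‖toL2 m F (coordMul j f)‖ * ‖toL2 m F (partialD j f)‖) := by
  have h : (‖toL2 m F f‖ : ℂ) ^ 2 = -⟪toL2 m F (partialD j f), toL2 m F (coordMul j f)⟫_ℂ -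
      ⟪toL2 m F (coordMul j f), toL2 m F (partialD j f)⟫_ℂ := by
    have h1 := partialD_coordMul j j f
    rw [if_pos rfl] at h1
    rw [inner_partialD, inner_coordMul, neg_neg, h1, map_add, inner_add_right,
      inner_self_eq_norm_sq_to_K]
    simp
  have h2 := congrArg norm h
  rw [norm_pow, Complex.norm_real, norm_norm] at h2
  rw [h2]
  refine (norm_sub_le _ _).trans ?_
  rw [norm_neg]
  have := norm_inner_le_norm (𝕜 := ℂ) (toL2 m F (partialD j f)) (toL2 m F (coordMul j f))
  have := norm_inner_le_norm (𝕜 := ℂ) (toL2 m F (coordMul j f)) (toL2 m F (partialD j f))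
  linarith [mul_comm ‖toL2 m F (coordMul j f)‖ ‖toL2 m F (partialD j f)‖]

/-- Heisenberg's inequality. -/
theorem heisenberg (f : 𝓢(E m, F)) :
    (m : ℝ) / 2 * ‖toL2 m F f‖ ^ 2 ≤ √(∑ j, ‖toL2 m F (coordMul j f)‖ ^ 2) *
      √(∑ j, ‖toL2 m F (partialD j f)‖ ^ 2) := by
  calc (m : ℝ) / 2 * ‖toL2 m F f‖ ^ 2 = ∑ _j : Fin m, ‖toL2 m F f‖ ^ 2 / 2 := by
        simp; ring
    _ ≤ ∑ j, ‖toL2 m F (coordMul j f)‖ * ‖toL2 m F (partialD j f)‖ :=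
        Finset.sum_le_sum fun j _ => by linarith [norm_sq_le_coordMul_partialD j f]
    _ ≤ _ := Real.sum_mul_le_sqrt_mul_sqrt _ _ _

/-- A single coordinate suffices, by the uncertainty bound and the AM–GM inequality; this is where
`m ≥ 1` enters. The sharp constant `m` is not needed: `H ≥ 1` already makes `‖H^N f‖` increase with
`N`. -/
theorem norm_sq_le_inner_hermite (hm : 1 ≤ m) (f : 𝓢(E m, F)) :
    ‖toL2 m F f‖ ^ 2 ≤
      ∑ j, (‖toL2 m F (coordMul j f)‖ ^ 2 + ‖toL2 m F (partialD j f)‖ ^ 2) := by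
  have h1 : ∀ j : Fin m, ‖toL2 m F f‖ ^ 2 ≤
      ‖toL2 m F (coordMul j f)‖ ^ 2 + ‖toL2 m F (partialD j f)‖ ^ 2 := fun j => by
    nlinarith [norm_sq_le_coordMul_partialD j f,
      sq_nonneg (‖toL2 m F (coordMul j f)‖ - ‖toL2 m F (partialD j f)‖)]
  exact (h1 ⟨0, hm⟩).trans (Finset.single_le_sum
    (f := fun j => ‖toL2 m F (coordMul j f)‖ ^ 2 + ‖toL2 m F (partialD j f)‖ ^ 2)
    (fun j _ => by positivity) (Finset.mem_univ _))

theorem inner_hermite_self_le (f : 𝓢(E m, F)) :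
    ∑ j, (‖toL2 m F (coordMul j f)‖ ^ 2 + ‖toL2 m F (partialD j f)‖ ^ 2) ≤
      ‖toL2 m F f‖ * ‖toL2 m F (hermite m F f)‖ := by
  have h := norm_inner_le_norm (𝕜 := ℂ) (toL2 m F f) (toL2 m F (hermite m F f))
  rw [inner_hermite_self, Complex.norm_real] at h
  exact (le_abs_self _).trans h

theorem norm_le_norm_hermite (hm : 1 ≤ m) (f : 𝓢(E m, F)) :
    ‖toL2 m F f‖ ≤ ‖toL2 m F (hermite m F f)‖ := by
  have h := (norm_sq_le_inner_hermite hm f).trans (inner_hermite_self_le f)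
  by_contra! hlt
  nlinarith [norm_nonneg (toL2 m F (hermite m F f))]

theorem norm_hermite_pow_mono (hm : 1 ≤ m) {N N' : ℕ} (h : N ≤ N') (f : 𝓢(E m, F)) :
    ‖toL2 m F ((hermite m F ^ N) f)‖ ≤ ‖toL2 m F ((hermite m F ^ N') f)‖ := by
  induction N', h using Nat.le_induction with
  | base => exact le_rfl
  | succ n _ ih =>
    rw [pow_succ', Module.End.mul_apply]
    exact ih.trans (norm_le_norm_hermite hm _)

end Oscillator

/-! ### Polynomial differential operators are bounded by powers of the oscillator -/

section Tame

variable {m : ℕ} {F : Type*} [NormedAddCommGroup F] [InnerProductSpace ℂ F]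

/-- The span of the coordinate multiplications and the partial derivatives. -/
def ladder (m : ℕ) (F : Type*) [NormedAddCommGroup F] [InnerProductSpace ℂ F] :
    Submodule ℂ (Module.End ℂ 𝓢(E m, F)) :=
  Submodule.span ℂ (Set.range coordMul ∪ Set.range partialD)

theorem coordMul_mem_ladder (j : Fin m) : coordMul j ∈ ladder m F :=
  Submodule.subset_span (Or.inl ⟨j, rfl⟩)

theorem partialD_mem_ladder (j : Fin m) : partialD j ∈ ladder m F :=
  Submodule.subset_span (Or.inr ⟨j, rfl⟩)

theorem hermite_coordMul (j : Fin m) (f : 𝓢(E m, F)) :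
    hermite m F (coordMul j f) = coordMul j (hermite m F f) - (2 : ℂ) • partialD j f := by
  simp only [hermite, LinearMap.sum_apply, LinearMap.sub_apply, Module.End.mul_apply, map_sum,
    map_sub, partialD_coordMul, map_add]
  have h : ∀ i : Fin m, coordMul i (coordMul i (coordMul j f)) -
      (coordMul j (partialD i (partialD i f)) + (if i = j then partialD i f else 0) +
        partialD i (if i = j then f else 0)) =
      coordMul j (coordMul i (coordMul i f)) - coordMul j (partialD i (partialD i f)) -
        if i = j then (2 : ℂ) • partialD j f else 0 := by
    intro i
    rw [coordMul_comm i j f, coordMul_comm i j]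
    by_cases hij : i = j
    · subst hij; simp only [if_true, two_smul]; abel
    · simp [hij]
  simp [h]

theorem hermite_partialD (j : Fin m) (f : 𝓢(E m, F)) :
    hermite m F (partialD j f) = partialD j (hermite m F f) - (2 : ℂ) • coordMul j f := by
  simp only [hermite, LinearMap.sum_apply, LinearMap.sub_apply, Module.End.mul_apply, map_sum,
    map_sub, partialD_coordMul, map_add]
  have h : ∀ i : Fin m, coordMul i (coordMul i (partialD j f)) -
      partialD i (partialD i (partialD j f))
      = coordMul i (coordMul i (partialD j f)) + coordMul i (if j = i then f else 0) +
        (if j = i then coordMul i f else 0) - partialD j (partialD i (partialD i f)) -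
        if i = j then (2 : ℂ) • coordMul j f else 0 := by
    intro i
    rw [partialD_comm j i, partialD_comm j i]
    by_cases hij : i = j
    · subst hij; simp only [if_true, two_smul]; abel
    · simp [hij, Ne.symm hij]
  simp [h]

/-- The relations `[H, x_j] = -2 ∂_j` and `[H, ∂_j] = -2 x_j` show that commuting with `H` does not
raise the order. -/
theorem hermite_commutator_mem {B : Module.End ℂ 𝓢(E m, F)} (hB : B ∈ ladder m F) :
    hermite m F * B - B * hermite m F ∈ ladder m F := by
  induction hB using Submodule.span_induction with
  | mem B hB =>
    rcases hB with ⟨j, rfl⟩ | ⟨j, rfl⟩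
    · have : hermite m F * coordMul j - coordMul j * hermite m F = (-2 : ℂ) • partialD j :=
        LinearMap.ext fun f => by simp [hermite_coordMul]
      rw [this]
      exact Submodule.smul_mem _ _ (partialD_mem_ladder j)
    · have : hermite m F * partialD j - partialD j * hermite m F = (-2 : ℂ) • coordMul j :=
        LinearMap.ext fun f => by simp [hermite_partialD]
      rw [this]
      exact Submodule.smul_mem _ _ (coordMul_mem_ladder j)
  | zero => simp
  | add B B' _ _ h h' =>
    have : hermite m F * (B + B') - (B + B') * hermite m F =
      (hermite m F * B - B * hermite m F) + (hermite m F * B' - B' * hermite m F) := by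
      noncomm_ring
    rw [this]; exact Submodule.add_mem _ h h'
  | smul c B _ h =>
    rw [mul_smul_comm, smul_mul_assoc, ← smul_sub]; exact Submodule.smul_mem _ _ h

/-- A linear map on Schwartz functions that is bounded by a power of the harmonic oscillator. -/
def HermiteBounded {m : ℕ} {F : Type*} [NormedAddCommGroup F] [InnerProductSpace ℂ F]
    (q : 𝓢(E m, F) → ℝ) : Prop :=
  ∃ (N : ℕ) (C : ℝ), 0 ≤ C ∧ ∀ f, q f ≤ C * ‖toL2 m F ((hermite m F ^ N) f)‖

theorem HermiteBounded.add (hm : 1 ≤ m) {q q' : 𝓢(E m, F) → ℝ} (h : HermiteBounded q)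
    (h' : HermiteBounded q') : HermiteBounded fun f => q f + q' f := by
  obtain ⟨N, C, hC, h⟩ := h
  obtain ⟨N', C', hC', h'⟩ := h'
  refine ⟨max N N', C + C', by positivity, fun f => ?_⟩
  rw [add_mul]
  refine add_le_add ((h f).trans ?_) ((h' f).trans ?_)
  · exact mul_le_mul_of_nonneg_left (norm_hermite_pow_mono hm (le_max_left _ _) f) hC
  · exact mul_le_mul_of_nonneg_left (norm_hermite_pow_mono hm (le_max_right _ _) f) hC'

theorem HermiteBounded.const_mul {q : 𝓢(E m, F) → ℝ} (h : HermiteBounded q) {c : ℝ} (hc : 0 ≤ c) :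
    HermiteBounded fun f => c * q f := by
  obtain ⟨N, C, hC, h⟩ := h
  exact ⟨N, c * C, by positivity, fun f => by
    rw [mul_assoc]; exact mul_le_mul_of_nonneg_left (h f) hc⟩

theorem HermiteBounded.mono {q q' : 𝓢(E m, F) → ℝ} (h : HermiteBounded q) (hq : ∀ f, q' f ≤ q f) :
    HermiteBounded q' := by
  obtain ⟨N, C, hC, h⟩ := h
  exact ⟨N, C, hC, fun f => (hq f).trans (h f)⟩

theorem HermiteBounded.zero : HermiteBounded fun _ : 𝓢(E m, F) => (0 : ℝ) :=
  ⟨0, 0, le_rfl, fun f => by simp⟩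

theorem HermiteBounded.sum (hm : 1 ≤ m) {ι : Type*} (s : Finset ι) {q : ι → 𝓢(E m, F) → ℝ}
    (h : ∀ i ∈ s, HermiteBounded (q i)) : HermiteBounded fun f => ∑ i ∈ s, q i f := by
  classical
  induction s using Finset.induction_on with
  | empty => simpa using HermiteBounded.zero
  | insert i s hi ih =>
    simp only [Finset.sum_insert hi]
    exact (h i (Finset.mem_insert_self i s)).add hm
      (ih fun j hj => h j (Finset.mem_insert_of_mem hj))

theorem HermiteBounded.comp_hermite {q : 𝓢(E m, F) → ℝ} (h : HermiteBounded q) :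
    HermiteBounded fun f => q (hermite m F f) := by
  obtain ⟨N, C, hC, h⟩ := h
  refine ⟨N + 1, C, hC, fun f => ?_⟩
  rw [pow_succ, Module.End.mul_apply]
  exact h _

/-- With `g = B f`, both `‖x_j g‖²` and `‖∂_j g‖²` are at most `⟨g, H g⟩ ≤ ‖g‖ ‖H g‖`, so one more
ladder factor costs only control of `H g`. -/
theorem HermiteBounded.norm_ladder_apply (hm : 1 ≤ m) {B D : Module.End ℂ 𝓢(E m, F)}
    (hB : HermiteBounded fun f => ‖toL2 m F (B f)‖)
    (hHB : HermiteBounded fun f => ‖toL2 m F (hermite m F (B f))‖) (hD : D ∈ ladder m F) :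
    HermiteBounded fun f => ‖toL2 m F (D (B f))‖ := by
  have hs := hB.add hm hHB
  have key : ∀ f, ∑ j, (‖toL2 m F (coordMul j (B f))‖ ^ 2 + ‖toL2 m F (partialD j (B f))‖ ^ 2) ≤
      (‖toL2 m F (B f)‖ + ‖toL2 m F (hermite m F (B f))‖) ^ 2 := fun f => by
    refine (inner_hermite_self_le (B f)).trans ?_
    nlinarith [norm_nonneg (toL2 m F (B f)), norm_nonneg (toL2 m F (hermite m F (B f)))]
  induction hD using Submodule.span_induction with
  | mem D hD =>
    rcases hD with ⟨j, rfl⟩ | ⟨j, rfl⟩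
    · refine hs.mono fun f => ?_
      refine abs_le_of_sq_le_sq' (le_trans ?_ (key f)) (by positivity) |>.2
      refine le_trans ?_ (Finset.single_le_sum (f := fun j => ‖toL2 m F (coordMul j (B f))‖ ^ 2 +
        ‖toL2 m F (partialD j (B f))‖ ^ 2) (fun j _ => by positivity) (Finset.mem_univ j))
      exact le_add_of_nonneg_right (by positivity)
    · refine hs.mono fun f => ?_
      refine abs_le_of_sq_le_sq' (le_trans ?_ (key f)) (by positivity) |>.2
      refine le_trans ?_ (Finset.single_le_sum (f := fun j => ‖toL2 m F (coordMul j (B f))‖ ^ 2 +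
        ‖toL2 m F (partialD j (B f))‖ ^ 2) (fun j _ => by positivity) (Finset.mem_univ j))
      exact le_add_of_nonneg_left (by positivity)
  | zero => simpa using HermiteBounded.zero
  | add D D' _ _ h h' => exact (h.add hm h').mono fun f => by simpa using norm_add_le _ _
  | smul c D _ h => exact (h.const_mul (norm_nonneg c)).mono fun f => by simp [norm_smul]

/-- The span of the products of `n` elements of `ladder`. -/
def ladderPow (m : ℕ) (F : Type*) [NormedAddCommGroup F] [InnerProductSpace ℂ F] :
    ℕ → Submodule ℂ (Module.End ℂ 𝓢(E m, F))
  | 0 => 1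
  | n + 1 => ladder m F * ladderPow m F n

/-- The two conclusions are proved together: bounding `D B f` requires a bound on `H B f = B H f +
[H, B] f`, and the commutator is covered by the induction hypothesis only because it has the same
order as `B`. -/
theorem hermiteBounded_of_mem_ladderPow (hm : 1 ≤ m) (n : ℕ) {B : Module.End ℂ 𝓢(E m, F)}
    (hB : B ∈ ladderPow m F n) :
    HermiteBounded (fun f => ‖toL2 m F (B f)‖) ∧
      hermite m F * B - B * hermite m F ∈ ladderPow m F n := by
  induction n generalizing B with
  | zero =>
    rw [ladderPow, Submodule.mem_one] at hB
    obtain ⟨c, rfl⟩ := hB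
    refine ⟨⟨0, ‖c‖, norm_nonneg c, fun f => ?_⟩, ?_⟩
    · simp [Module.algebraMap_end_apply, norm_smul]
    · rw [(Algebra.commutes c (hermite m F)).symm, sub_self]
      exact Submodule.zero_mem _
  | succ n ih =>
    rw [ladderPow] at hB ⊢
    induction hB using Submodule.mul_induction_on' with
    | mem_mul_mem D hD B hB =>
      obtain ⟨h1, h2⟩ := ih hB
      constructor
      · refine h1.norm_ladder_apply hm ?_ hD
        refine (h1.comp_hermite.add hm (ih h2).1).mono fun f => ?_
        have : hermite m F (B f) = B (hermite m F f) +
          (hermite m F * B - B * hermite m F) f := by simp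
        rw [this, map_add]
        exact norm_add_le _ _
      · have : hermite m F * (D * B) - D * B * hermite m F =
          (hermite m F * D - D * hermite m F) * B + D * (hermite m F * B - B * hermite m F) := by
          noncomm_ring
        rw [this]
        exact Submodule.add_mem _ (Submodule.mul_mem_mul (hermite_commutator_mem hD) hB)
          (Submodule.mul_mem_mul hD h2)
    | add B _ B' _ h h' =>
      refine ⟨(h.1.add hm h'.1).mono fun f => by simpa using norm_add_le _ _, ?_⟩
      have : hermite m F * (B + B') - (B + B') * hermite m F =
        (hermite m F * B - B * hermite m F) + (hermite m F * B' - B' * hermite m F) := by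
        noncomm_ring
      rw [this]; exact Submodule.add_mem _ h.2 h'.2

/-- The algebra of differential operators with polynomial coefficients. -/
def weyl (m : ℕ) (F : Type*) [NormedAddCommGroup F] [InnerProductSpace ℂ F] :
    Subalgebra ℂ (Module.End ℂ 𝓢(E m, F)) :=
  Algebra.adjoin ℂ (Set.range coordMul ∪ Set.range partialD)

theorem coordMul_mem_weyl (j : Fin m) : coordMul j ∈ weyl m F :=
  Algebra.subset_adjoin (Or.inl ⟨j, rfl⟩)

theorem partialD_mem_weyl (j : Fin m) : partialD j ∈ weyl m F :=
  Algebra.subset_adjoin (Or.inr ⟨j, rfl⟩)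

theorem hermiteBounded_of_mem_weyl (hm : 1 ≤ m) {B : Module.End ℂ 𝓢(E m, F)}
    (hB : B ∈ weyl m F) : HermiteBounded fun f => ‖toL2 m F (B f)‖ := by
  rw [← Subalgebra.mem_toSubmodule, weyl, Algebra.adjoin_eq_span] at hB
  induction hB using Submodule.span_induction with
  | mem B hB =>
    have : ∃ n, B ∈ ladderPow m F n := by
      induction hB using Submonoid.closure_induction_left with
      | one => exact ⟨0, Submodule.one_le.mp le_rfl⟩
      | mul_left D hD B _ h =>
        obtain ⟨n, hn⟩ := h
        exact ⟨n + 1, Submodule.mul_mem_mul (Submodule.subset_span hD) hn⟩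
    obtain ⟨n, hn⟩ := this
    exact (hermiteBounded_of_mem_ladderPow hm n hn).1
  | zero => simpa using HermiteBounded.zero
  | add B B' _ _ h h' => exact (h.add hm h').mono fun f => by simpa using norm_add_le _ _
  | smul c B _ h => exact (h.const_mul (norm_nonneg c)).mono fun f => by simp [norm_smul]

end Tame

/-! ### Sobolev inequality and control of the Schwartz seminorms -/

section Sobolev

variable {m : ℕ} {F : Type*} [NormedAddCommGroup F] [InnerProductSpace ℂ F]

/-- Multiplication by `1 + |x|²`. -/
def japanese (m : ℕ) (F : Type*) [NormedAddCommGroup F] [InnerProductSpace ℂ F] :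
    Module.End ℂ 𝓢(E m, F) :=
  1 + ∑ j, coordMul j * coordMul j

theorem japanese_apply (h : 𝓢(E m, F)) (x : E m) :
    japanese m F h x = ((1 + ‖x‖ ^ 2 : ℝ) : ℂ) • h x := by
  have : japanese m F h x = h x + ∑ j, (x j : ℂ) • (x j : ℂ) • h x := by
    simp [japanese, coordMul_apply]
  rw [this, EuclideanSpace.norm_sq_eq]
  push_cast
  simp only [add_smul, one_smul, Finset.sum_smul, smul_smul, sq, Real.norm_eq_abs]
  congr 1
  refine Finset.sum_congr rfl fun j _ => ?_
  rw [← Complex.ofReal_mul, ← Complex.ofReal_mul, abs_mul_abs_self]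

theorem japanese_pow_apply (n : ℕ) (h : 𝓢(E m, F)) (x : E m) :
    (japanese m F ^ n) h x = ((1 + ‖x‖ ^ 2 : ℝ) : ℂ) ^ n • h x := by
  induction n with
  | zero => simp
  | succ n ih => rw [pow_succ', Module.End.mul_apply, japanese_apply, ih, smul_smul, ← pow_succ']

/-- Cauchy–Schwarz against the weight `(1 + |x|²)^{-(m+1)}`, whose square is integrable because `4(m
+ 1) > m`. -/
theorem exists_integral_norm_le (m : ℕ) (F : Type*) [NormedAddCommGroup F]
    [InnerProductSpace ℂ F] : ∃ C : ℝ, 0 ≤ C ∧ ∀ h : 𝓢(E m, F),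
      ‖h.toLp 1 (volume : Measure (E m))‖ ≤ C * ‖toL2 m F ((japanese m F ^ (m + 1)) h)‖ := by
  set w : E m → ℝ := fun x => ((1 + ‖x‖ ^ 2) ^ (m + 1))⁻¹ with hw
  have hw0 : ∀ x, 0 ≤ w x := fun x => by positivity
  have hint : Integrable (fun x : E m => w x ^ 2) := by
    have := integrable_rpow_neg_one_add_norm_sq (E := E m) (μ := volume) (r := 4 * (m + 1))
      (by simp; linarith)
    refine this.congr (Filter.Eventually.of_forall fun x => ?_)
    have h1 : (0 : ℝ) < 1 + ‖x‖ ^ 2 := by positivity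
    simp only [hw]
    rw [show -(4 * ((m : ℝ) + 1)) / 2 = -((2 * (m + 1) : ℕ) : ℝ) by push_cast; ring,
      Real.rpow_neg h1.le, Real.rpow_natCast, mul_comm 2, pow_mul, inv_pow]
  have hwm : MemLp w (ENNReal.ofReal 2) := by
    rw [ENNReal.ofReal_ofNat]
    refine (memLp_two_iff_integrable_sq (Continuous.aestronglyMeasurable ?_)).mpr hint
    exact Continuous.inv₀ (by fun_prop) fun x => by positivity
  refine ⟨(∫ x, w x ^ (2 : ℝ)) ^ (1 / (2 : ℝ)), by positivity, fun h => ?_⟩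
  set g := (japanese m F ^ (m + 1)) h with hg
  have hgm : MemLp (fun x => ‖g x‖) (ENNReal.ofReal 2) := by
    rw [ENNReal.ofReal_ofNat]
    exact (g.memLp 2 volume).norm
  have hh : ∀ x, ‖h x‖ = w x * ‖g x‖ := fun x => by
    have h1 : (0 : ℝ) < 1 + ‖x‖ ^ 2 := by positivity
    rw [hg, japanese_pow_apply, norm_smul, norm_pow, Complex.norm_real, Real.norm_of_nonneg h1.le,
      hw]
    field_simp
  have hn : ‖toL2 m F g‖ = (∫ x, ‖g x‖ ^ (2 : ℝ)) ^ (1 / (2 : ℝ)) := by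
    have := norm_toLp' (f := g) (p := 2) (μ := volume) (by simp) (by simp)
    simp only [ENNReal.toReal_ofNat] at this
    rw [one_div]
    exact this
  rw [norm_toLp_one, hn]
  simp only [hh]
  exact integral_mul_le_Lp_mul_Lq_of_nonneg Real.HolderConjugate.two_two
    (Filter.Eventually.of_forall hw0) (Filter.Eventually.of_forall fun x => norm_nonneg _) hwm hgm

theorem partialD_fourier [CompleteSpace F] (j : Fin m) (h : 𝓢(E m, F)) :
    partialD j (𝓕 h) = (-(2 * Real.pi * Complex.I)) • 𝓕 (coordMul j h) := by
  rw [partialD_eq, lineDerivOp_fourier_eq, ← FourierTransform.fourier_smul]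
  congr 2
  ext x
  have : (inner ℝ · (EuclideanSpace.single j (1 : ℝ)) : E m → ℝ).HasTemperateGrowth := by fun_prop
  rw [smulLeftCLM_apply_apply this, coordMul_apply]
  simp [EuclideanSpace.inner_single_right]

/-- The Fourier conjugate of `1 + |x|²`. -/
def bessel (m : ℕ) (F : Type*) [NormedAddCommGroup F] [InnerProductSpace ℂ F] :
    Module.End ℂ 𝓢(E m, F) :=
  -- The Fourier kernel is `e^{-2πi⟨x,ξ⟩}`, so multiplication by `x_j²` becomes `(2πi)⁻² ∂_j²`.
  1 + ((2 * Real.pi * Complex.I) ^ 2)⁻¹ • ∑ j, partialD j * partialD j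

theorem fourier_japanese [CompleteSpace F] (h : 𝓢(E m, F)) :
    𝓕 (japanese m F h) = bessel m F (𝓕 h) := by
  have h1 : ∀ j : Fin m, partialD j (partialD j (𝓕 h)) =
      (2 * Real.pi * Complex.I : ℂ) ^ 2 • 𝓕 (coordMul j (coordMul j h)) := fun j => by
    rw [partialD_fourier, map_smul, partialD_fourier, smul_smul]
    ring_nf
  have h2 : 𝓕 (japanese m F h) = 𝓕 h + ∑ j, 𝓕 (coordMul j (coordMul j h)) := by
    have : japanese m F h = h + ∑ j, coordMul j (coordMul j h) := by simp [japanese]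
    rw [this, FourierTransform.fourier_add]
    congr 1
    exact map_sum (fourierTransformCLM ℂ) _ _
  simp [h2, bessel, h1, ← Finset.smul_sum, smul_smul]

theorem fourier_japanese_pow [CompleteSpace F] (n : ℕ) (h : 𝓢(E m, F)) :
    𝓕 ((japanese m F ^ n) h) = (bessel m F ^ n) (𝓕 h) := by
  induction n with
  | zero => simp
  | succ n ih =>
    rw [pow_succ', Module.End.mul_apply, fourier_japanese, ih, pow_succ', Module.End.mul_apply]

theorem bessel_mem_weyl : bessel m F ∈ weyl m F := by
  refine add_mem (one_mem _) (Subalgebra.smul_mem _ (sum_mem fun j _ => ?_) _)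
  exact mul_mem (partialD_mem_weyl j) (partialD_mem_weyl j)

/-- A Sobolev inequality. -/
theorem exists_norm_apply_le (m : ℕ) (F : Type*) [NormedAddCommGroup F]
    [InnerProductSpace ℂ F] [CompleteSpace F] : ∃ C : ℝ, 0 ≤ C ∧ ∀ (f : 𝓢(E m, F)) (x : E m),
      ‖f x‖ ≤ C * ‖toL2 m F ((bessel m F ^ (m + 1)) f)‖ := by
  obtain ⟨C, hC, h⟩ := exists_integral_norm_le m F
  refine ⟨C, hC, fun f x => ?_⟩
  -- The sup norm of `f` is at most the `L¹` norm of its inverse transform; the weighted `L²` bound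
  -- and Plancherel then carry the estimate back to `f`.
  have h1 := norm_fourier_apply_le_toLp_one (𝓕⁻ f) x
  rw [FourierTransform.fourier_fourierInv_eq] at h1
  refine h1.trans ((h _).trans_eq ?_)
  congr 1
  have h2 := norm_fourier_toL2_eq ((japanese m F ^ (m + 1)) (𝓕⁻ f))
  rw [fourier_japanese_pow, FourierTransform.fourier_fourierInv_eq] at h2
  exact h2.symm

/-- Since `|x| ≤ ∑ |x_j|`, each power of `|x|` can be absorbed into the operator as a factor `x_j`.
Quantifying over all `B` in the Weyl algebra is what lets the induction on `k` close. -/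
theorem hermiteBounded_seminorm_zero [CompleteSpace F] (hm : 1 ≤ m) (k : ℕ)
    {B : Module.End ℂ 𝓢(E m, F)} (hB : B ∈ weyl m F) :
    HermiteBounded fun f => SchwartzMap.seminorm ℝ k 0 (B f) := by
  induction k generalizing B with
  | zero =>
    obtain ⟨C, hC, h⟩ := exists_norm_apply_le m F
    have h1 := (hermiteBounded_of_mem_weyl hm
      (mul_mem (pow_mem bessel_mem_weyl (m + 1)) hB)).const_mul hC
    refine h1.mono fun f => ?_
    refine seminorm_le_bound ℝ 0 0 _ (by positivity) fun x => ?_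
    simpa using h (B f) x
  | succ k ih =>
    have h1 := HermiteBounded.sum hm Finset.univ fun j (_ : j ∈ Finset.univ) =>
      ih (mul_mem (coordMul_mem_weyl j) hB)
    refine h1.mono fun f => ?_
    refine seminorm_le_bound ℝ _ 0 _ (by positivity) fun x => ?_
    have h2 : ‖x‖ ≤ ∑ j, |x j| := by
      rw [EuclideanSpace.norm_eq]
      refine Real.sqrt_le_iff.mpr ⟨by positivity, ?_⟩
      simp only [Real.norm_eq_abs]
      exact Finset.sum_sq_le_sq_sum_of_nonneg fun j _ => abs_nonneg _
    rw [norm_iteratedFDeriv_zero, pow_succ, mul_assoc]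
    calc ‖x‖ ^ k * (‖x‖ * ‖B f x‖) ≤ ‖x‖ ^ k * ((∑ j, |x j|) * ‖B f x‖) := by gcongr
      _ = ∑ j, ‖x‖ ^ k * ‖((coordMul j * B : Module.End ℂ 𝓢(E m, F)) f) x‖ := by
        simp [Finset.sum_mul, Finset.mul_sum, coordMul_apply, norm_smul]
      _ ≤ _ := Finset.sum_le_sum fun j _ => norm_pow_mul_le_seminorm ℝ _ k x

theorem fderivCLM_eq_sum (f : 𝓢(E m, F)) :
    fderivCLM ℝ (E m) F f = ∑ j, postcompCLM
      (ContinuousLinearMap.smulRightL ℝ (E m) F (EuclideanSpace.proj j)) (partialD j f) := by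
  ext x v
  have hv : v = ∑ j, v j • EuclideanSpace.single j (1 : ℝ) := by
    ext i; simp [Pi.single_apply]
  conv_lhs => rw [fderivCLM_apply, hv, map_sum]
  simp [partialD_apply]

/-- The Fréchet derivative is a finite sum of partial derivatives, each of which is absorbed into
`B`, lowering the order `n` by one. -/
theorem hermiteBounded_seminorm [CompleteSpace F] (hm : 1 ≤ m) (k n : ℕ)
    {B : Module.End ℂ 𝓢(E m, F)} (hB : B ∈ weyl m F) :
    HermiteBounded fun f => SchwartzMap.seminorm ℝ k n (B f) := by
  induction n generalizing B with
  | zero => exact hermiteBounded_seminorm_zero hm k hB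
  | succ n ih =>
    set L : Fin m → F →L[ℝ] E m →L[ℝ] F := fun j =>
      ContinuousLinearMap.smulRightL ℝ (E m) F (EuclideanSpace.proj j) with hL
    have h1 := HermiteBounded.sum hm Finset.univ fun j (_ : j ∈ Finset.univ) =>
      (ih (mul_mem (partialD_mem_weyl j) hB)).const_mul (norm_nonneg (L j))
    refine h1.mono fun f => ?_
    have h2 : SchwartzMap.seminorm ℝ k (n + 1) (B f) ≤
        SchwartzMap.seminorm ℝ k n (fderivCLM ℝ (E m) F (B f)) := by
      refine seminorm_le_bound ℝ _ _ _ (by positivity) fun x => ?_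
      rw [← norm_iteratedFDeriv_fderiv]
      exact le_seminorm ℝ k n (fderivCLM ℝ (E m) F (B f)) x
    refine h2.trans ?_
    rw [fderivCLM_eq_sum]
    refine (Finset.le_sum_of_subadditive _ (map_zero _).le (map_add_le_add _) _ _).trans
      (Finset.sum_le_sum fun j _ => ?_)
    refine seminorm_le_bound ℝ _ _ _ (by positivity) fun x => ?_
    have h3 := (L j).norm_iteratedFDeriv_comp_left (f := partialD j (B f)) (x := x) (N := (⊤ : ℕ∞))
      (n := n) ((partialD j (B f)).smooth ⊤).contDiffAt (by exact_mod_cast le_top)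
    calc _ ≤ ‖x‖ ^ k * (‖L j‖ * ‖iteratedFDeriv ℝ n (partialD j (B f)) x‖) := by
          gcongr; exact h3
      _ = ‖L j‖ * (‖x‖ ^ k * ‖iteratedFDeriv ℝ n (partialD j (B f)) x‖) := by ring
      _ ≤ _ := by gcongr; exact le_seminorm ℝ k n (partialD j (B f)) x

/-- Powers of the harmonic oscillator control every continuous seminorm. -/
theorem hermiteBounded_norm_continuous [CompleteSpace F] (hm : 1 ≤ m) {G : Type*}
    [NormedAddCommGroup G] [NormedSpace ℝ G] (T : 𝓢(E m, F) →L[ℝ] G) :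
    HermiteBounded fun f => ‖T f‖ := by
  obtain ⟨s, C, _, h⟩ := Seminorm.bound_of_continuous (schwartz_withSeminorms ℝ (E m) F)
    ((normSeminorm ℝ G).comp T.toLinearMap) (continuous_norm.comp T.continuous)
  have h1 := HermiteBounded.sum hm s fun i (_ : i ∈ s) =>
    hermiteBounded_seminorm (F := F) hm i.1 i.2 (one_mem _)
  refine (h1.const_mul C.2).mono fun f => ?_
  refine (h f).trans ?_
  rw [_root_.smul_apply]
  refine mul_le_mul_of_nonneg_left ?_ C.2
  refine (Seminorm.le_def.mp (Seminorm.finset_sup_le_sum _ s) f).trans_eq ?_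
  exact map_sum (⟨⟨fun p : Seminorm ℝ 𝓢(E m, F) => p f, rfl⟩, fun _ _ => rfl⟩ :
    Seminorm ℝ 𝓢(E m, F) →+ ℝ) _ s

end Sobolev

/-! ### Polynomial moments against the Gaussian determine an `L²` function -/

section Density

variable {m : ℕ} {F : Type*} [NormedAddCommGroup F] [InnerProductSpace ℂ F]

theorem gaussian_apply (x : E m) : gaussian m x = Real.exp (-‖x‖ ^ 2 / 2) := rfl

theorem integrable_exp_mul_gaussian_smul {h : E m → F} (hh : MemLp h 2) (c : ℝ) :
    Integrable fun x => (Real.exp (c * ‖x‖) * gaussian m x) • h x := by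
  have hc : Continuous fun x : E m => Real.exp (c * ‖x‖) * gaussian m x :=
    (by fun_prop : Continuous fun x : E m => Real.exp (c * ‖x‖)).mul (gaussian m).continuous
  have hφ : MemLp (fun x : E m => Real.exp (c ^ 2) * Real.exp (-‖x‖ ^ 2 / 4)) 2 := by
    refine (memLp_two_iff_integrable_sq (Continuous.aestronglyMeasurable (by fun_prop))).mpr ?_
    refine ((gaussian m).integrable.const_mul (Real.exp (c ^ 2) ^ 2)).congr
      (Filter.Eventually.of_forall fun x => ?_)
    simp only [gaussian_apply]
    rw [mul_pow, ← Real.exp_nat_mul (-‖x‖ ^ 2 / 4)]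
    congr 2
    push_cast; ring
  have hψ : MemLp (fun x : E m => Real.exp (c * ‖x‖) * gaussian m x) 2 := by
    refine hφ.mono hc.aestronglyMeasurable (Filter.Eventually.of_forall fun x => ?_)
    rw [gaussian_apply, ← Real.exp_add, ← Real.exp_add, Real.norm_eq_abs, Real.norm_eq_abs,
      Real.abs_exp, Real.abs_exp]
    refine Real.exp_le_exp.mpr ?_
    -- Completing the square: `c|x| - |x|²/2 ≤ c² - |x|²/4`.
    nlinarith [sq_nonneg (‖x‖ / 2 - c)]
  have := hψ.integrable_mul hh.norm
  refine this.mono (hc.aestronglyMeasurable.smul hh.1) (Filter.Eventually.of_forall fun x => ?_)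
  simp [norm_smul]

/-- Expand the exponential in the Fourier integral as a power series. Every term is a polynomial
moment, hence zero, and exponential integrability of the Gaussian times `h` justifies the
interchange of sum and integral. -/
theorem fourier_gaussian_smul_eq_zero [CompleteSpace F] {h : E m → F} (hh : MemLp h 2)
    (hP : ∀ P : MvPolynomial (Fin m) ℂ,
      ∫ x : E m, MvPolynomial.eval (fun j => (x j : ℂ)) P • gaussian m x • h x = 0) (ξ : E m) :
    𝓕 (fun x => gaussian m x • h x) ξ = 0 := by
  set k : E m → F := fun x => gaussian m x • h x with hk
  have hkm : AEStronglyMeasurable k volume := (gaussian m).continuous.aestronglyMeasurable.smul hh.1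
  set c : E m → ℂ := fun x => -(2 * Real.pi * Complex.I) * (inner ℝ x ξ : ℝ) with hc
  have hcc : Continuous c := by fun_prop
  have hcn : ∀ x, ‖c x‖ ≤ 2 * Real.pi * ‖ξ‖ * ‖x‖ := fun x => by
    have := norm_inner_le_norm (𝕜 := ℝ) x ξ
    simp only [hc, norm_mul, norm_neg, Complex.norm_real, Complex.norm_I, Complex.norm_ofNat,
      Real.norm_of_nonneg Real.pi_pos.le, mul_one]
    calc 2 * Real.pi * ‖inner ℝ x ξ‖ ≤ 2 * Real.pi * (‖x‖ * ‖ξ‖) := by gcongr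
      _ = _ := by ring
  have hsum := hasSum_integral_of_dominated_convergence (μ := (volume : Measure (E m)))
    (F := fun (n : ℕ) x => (((n.factorial : ℂ))⁻¹ * c x ^ n) • k x)
    (f := fun x => Complex.exp (c x) • k x)
    (fun n x => (2 * Real.pi * ‖ξ‖ * ‖x‖) ^ n / n.factorial * ‖k x‖)
    (fun n => (Continuous.aestronglyMeasurable (by fun_prop)).smul hkm)
    (fun n => Filter.Eventually.of_forall fun x => by
      rw [norm_smul, norm_mul, norm_inv, norm_pow, Complex.norm_natCast, div_eq_inv_mul]
      gcongr
      exact hcn x)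
    (Filter.Eventually.of_forall fun x =>
      (Real.summable_pow_div_factorial _).mul_right _)
    (by
      have := (integrable_exp_mul_gaussian_smul hh (2 * Real.pi * ‖ξ‖)).norm
      refine this.congr (Filter.Eventually.of_forall fun x => ?_)
      simp only
      rw [tsum_mul_right, mul_smul, norm_smul, Real.norm_eq_abs, Real.abs_exp, Real.exp_eq_exp_ℝ,
        NormedSpace.exp_eq_tsum_div])
    (Filter.Eventually.of_forall fun x => by
      refine HasSum.smul_const ?_ (k x)
      have := NormedSpace.exp_series_hasSum_exp' (𝕂 := ℂ) (c x)
      rw [← Complex.exp_eq_exp_ℂ] at this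
      simpa using this)
  have hz : ∀ n : ℕ, ∫ x, (((n.factorial : ℂ))⁻¹ * c x ^ n) • k x = 0 := fun n => by
    rw [← hP (MvPolynomial.C ((n.factorial : ℂ))⁻¹ *
      (∑ j, MvPolynomial.C (-(2 * Real.pi * Complex.I) * (ξ j : ℂ)) * MvPolynomial.X j) ^ n)]
    refine integral_congr_ae (Filter.Eventually.of_forall fun x => ?_)
    simp only [map_mul, map_pow, map_sum, MvPolynomial.eval_C, MvPolynomial.eval_X]
    congr 3
    simp only [hc, PiLp.inner_apply, Complex.ofReal_sum, Finset.mul_sum]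
    refine Finset.sum_congr rfl fun j _ => ?_
    simp; ring
  simp only [hz] at hsum
  have h0 := hsum.unique hasSum_zero
  rw [Real.fourier_eq']
  rw [← h0]
  refine integral_congr_ae (Filter.Eventually.of_forall fun x => ?_)
  simp only [hc]
  congr 2
  push_cast; ring

/-- Every test function is the Fourier transform of a Schwartz function, so moving the transform
across the integral makes the Gaussian times `h` vanish against all test functions. -/
theorem ae_eq_zero_of_forall_integral_polynomial_gaussian [CompleteSpace F] {h : E m → F}
    (hh : MemLp h 2) (hP : ∀ P : MvPolynomial (Fin m) ℂ,
      ∫ x : E m, MvPolynomial.eval (fun j => (x j : ℂ)) P • gaussian m x • h x = 0) :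
    h =ᵐ[volume] 0 := by
  have hi : Integrable fun x => gaussian m x • h x := by
    simpa using integrable_exp_mul_gaussian_smul hh 0
  have hz : ∀ᵐ x : E m, gaussian m x • h x = 0 := by
    refine ae_eq_zero_of_integral_contDiff_smul_eq_zero hi.locallyIntegrable
      fun φ hφ hφc => ?_
    have hφ' : ContDiff ℝ (⊤ : ℕ∞) fun x => (φ x : ℂ) := Complex.ofRealCLM.contDiff.comp hφ
    have hφc' : HasCompactSupport fun x => (φ x : ℂ) :=
      hφc.comp_left (g := ((↑) : ℝ → ℂ)) Complex.ofReal_zero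
    set Φ : 𝓢(E m, ℂ) := hφc'.toSchwartzMap hφ' with hΦ
    have h1 := VectorFourier.integral_bilin_fourierIntegral_eq_flip
      (ContinuousLinearMap.lsmul ℂ ℂ : ℂ →L[ℂ] F →L[ℂ] F) (L := innerₗ (E m))
      Real.continuous_fourierChar continuous_inner (𝓕⁻ Φ).integrable hi (μ := volume)
    have h2 : ∀ ξ, VectorFourier.fourierIntegral Real.fourierChar volume (innerₗ (E m))
        (𝓕⁻ Φ : 𝓢(E m, ℂ)) ξ = φ ξ := fun ξ => by
      change (𝓕 (𝓕⁻ Φ : 𝓢(E m, ℂ)) : 𝓢(E m, ℂ)) ξ = φ ξ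
      rw [FourierTransform.fourier_fourierInv_eq]
      rfl
    have h3 : ∀ ξ, VectorFourier.fourierIntegral Real.fourierChar volume (innerₗ (E m)).flip
        (fun x => gaussian m x • h x) ξ = 0 := fun ξ => by
      rw [flip_innerₗ]
      exact fourier_gaussian_smul_eq_zero hh hP ξ
    simp only [h2, h3, map_zero, integral_zero] at h1
    refine Eq.trans (integral_congr_ae (Filter.Eventually.of_forall fun x => ?_)) h1
    exact (Complex.coe_smul _ _).symm
  filter_upwards [hz] with x hx
  exact (smul_eq_zero.mp hx).resolve_left (Real.exp_pos _).ne'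

end Density

/-! ### Vector variable, Dirac operator, and their sum and difference -/

section CliffordOperators

variable {m : ℕ}

theorem Cl.inner_eq_scalarPart (u v : Cl m) : ⟪u, v⟫_ℂ = scalarPart (hconj u * v) := by
  rw [scalarPart_hconj_mul]
  refine (EuclideanSpace.inner_eq_star_dotProduct (𝕜 := ℂ) _ _).trans ?_
  refine Finset.sum_congr rfl fun A _ => mul_comm _ _

theorem Cl.inner_e_mul (j : Fin m) (u v : Cl m) : ⟪e j * u, v⟫_ℂ = -⟪u, e j * v⟫_ℂ := by
  rw [Cl.inner_eq_scalarPart, Cl.inner_eq_scalarPart, hconj_mul, hconj_e, mul_neg, neg_mul,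
    map_neg, mul_assoc]

/-- Left multiplication of Schwartz functions by `e_j`. -/
def leftMul (j : Fin m) : Module.End ℂ 𝓢(E m, Cl m) :=
  (postcompCLM (mulL m (e j)) : 𝓢(E m, Cl m) →L[ℂ] 𝓢(E m, Cl m)).toLinearMap

theorem leftMul_apply (j : Fin m) (f : 𝓢(E m, Cl m)) (x : E m) : leftMul j f x = e j * f x := rfl

theorem leftMul_coordMul (i j : Fin m) : Commute (leftMul i) (coordMul (F := Cl m) j) :=
  LinearMap.ext fun f => SchwartzMap.ext fun x => by
    simp [leftMul_apply, coordMul_apply]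

theorem leftMul_partialD (i j : Fin m) : Commute (leftMul i) (partialD (F := Cl m) j) :=
  LinearMap.ext fun f => SchwartzMap.ext fun x => by
    have h : HasFDerivAt (leftMul i f) (((mulL m (e i)).restrictScalars ℝ).comp (fderiv ℝ f x)) x :=
      ((mulL m (e i)).restrictScalars ℝ).hasFDerivAt.comp x (f.hasFDerivAt x)
    simp [leftMul_apply, partialD_apply, h.fderiv]

theorem mulX_eq : (mulX m).toLinearMap = ∑ j, leftMul j * coordMul j :=
  LinearMap.ext fun f => SchwartzMap.ext fun x => by
    simp [mulX_apply, xvec, leftMul_apply, coordMul_apply, Finset.sum_mul]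

theorem dirac_eq : (dirac m).toLinearMap = ∑ j, leftMul j * partialD j :=
  LinearMap.ext fun f => by
    simp [dirac, leftMul, partialD]

theorem leftMul_mul_self (j : Fin m) : leftMul j * leftMul j = -1 :=
  LinearMap.ext fun f => SchwartzMap.ext fun x => by
    simp [leftMul_apply, ← mul_assoc, e_mul_self]

theorem leftMul_anticomm (i j : Fin m) :
    leftMul i * leftMul j + leftMul j * leftMul i =
      (if i = j then -2 else 0 : Module.End ℂ 𝓢(E m, Cl m)) := by
  by_cases h : i = j
  · subst h; simp only [leftMul_mul_self, if_true]; norm_num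
  · refine LinearMap.ext fun f => SchwartzMap.ext fun x => ?_
    simp [h, leftMul_apply, ← mul_assoc, ← add_mul, e_mul_e_add i j h]

/-- Adding the double sum to its transpose turns `e_i e_j` into an anticommutator, which vanishes
off the diagonal. The statement is abstract in `Y` so that it serves for `x_j`, `∂_j` and `x_j +
∂_j`. -/
theorem sum_leftMul_mul_self {Y : Fin m → Module.End ℂ 𝓢(E m, Cl m)}
    (hY : ∀ i j, Commute (Y i) (Y j)) (hl : ∀ i j, Commute (leftMul i) (Y j)) :
    (∑ j, leftMul j * Y j) * (∑ j, leftMul j * Y j) = -∑ j, Y j * Y j := by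
  have h1 : (∑ j, leftMul j * Y j) * (∑ j, leftMul j * Y j) =
      ∑ i, ∑ j, leftMul i * leftMul j * (Y i * Y j) := by
    rw [Finset.sum_mul_sum]
    refine Finset.sum_congr rfl fun i _ => Finset.sum_congr rfl fun j _ => ?_
    rw [mul_assoc, ← mul_assoc (Y i), ← (hl j i).eq]; simp only [mul_assoc]
  have h2 : ∑ i, ∑ j, leftMul i * leftMul j * (Y i * Y j) =
      ∑ i, ∑ j, leftMul j * leftMul i * (Y i * Y j) := by
    rw [Finset.sum_comm]
    refine Finset.sum_congr rfl fun i _ => Finset.sum_congr rfl fun j _ => ?_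
    rw [(hY j i).eq]
  have h3 : (2 : ℂ) • ((∑ j, leftMul j * Y j) * (∑ j, leftMul j * Y j)) =
      (2 : ℂ) • (-∑ j, Y j * Y j) := by
    rw [h1, two_smul]
    nth_rewrite 2 [h2]
    simp only [← Finset.sum_add_distrib, ← add_mul, leftMul_anticomm]
    simp [two_smul, Finset.sum_add_distrib, two_mul]
  exact smul_right_injective _ (two_ne_zero (α := ℂ)) h3

theorem mulX_mul_mulX :
    (mulX m).toLinearMap * (mulX m).toLinearMap = -∑ j, coordMul j * coordMul j := by
  rw [mulX_eq]
  exact sum_leftMul_mul_self (fun i j => LinearMap.ext fun f => coordMul_comm i j f)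
    leftMul_coordMul

theorem dirac_mul_dirac :
    (dirac m).toLinearMap * (dirac m).toLinearMap = -∑ j, partialD j * partialD j := by
  rw [dirac_eq]
  exact sum_leftMul_mul_self (fun i j => LinearMap.ext fun f => partialD_comm i j f)
    leftMul_partialD

theorem inner_leftMul (j : Fin m) (f g : 𝓢(E m, Cl m)) :
    ⟪toL2 m (Cl m) (leftMul j f), toL2 m (Cl m) g⟫_ℂ =
      -⟪toL2 m (Cl m) f, toL2 m (Cl m) (leftMul j g)⟫_ℂ := by
  simp only [inner_toL2, leftMul_apply, Cl.inner_e_mul, integral_neg]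

/-- Left multiplication by `e_j` is skew and `x_j` is symmetric, so their product is skew. For the
Dirac operator both factors are skew and the signs cancel. -/
theorem inner_mulX (f g : 𝓢(E m, Cl m)) :
    ⟪toL2 m (Cl m) (mulX m f), toL2 m (Cl m) g⟫_ℂ =
      -⟪toL2 m (Cl m) f, toL2 m (Cl m) (mulX m g)⟫_ℂ := by
  have h : ∀ f, mulX m f = ∑ j, leftMul j (coordMul j f) := fun f => by
    simpa using LinearMap.congr_fun (mulX_eq (m := m)) f
  have hc : ∀ j g, coordMul j (leftMul j g) = leftMul j (coordMul j g) := fun j g =>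
    (LinearMap.congr_fun (leftMul_coordMul (m := m) j j).eq g).symm
  simp only [h, map_sum, sum_inner, inner_sum, inner_leftMul, inner_coordMul, hc,
    Finset.sum_neg_distrib]

theorem inner_dirac (f g : 𝓢(E m, Cl m)) :
    ⟪toL2 m (Cl m) (dirac m f), toL2 m (Cl m) g⟫_ℂ =
      ⟪toL2 m (Cl m) f, toL2 m (Cl m) (dirac m g)⟫_ℂ := by
  have h : ∀ f, dirac m f = ∑ j, leftMul j (partialD j f) := fun f => by
    simpa using LinearMap.congr_fun (dirac_eq (m := m)) f
  have hc : ∀ j g, partialD j (leftMul j g) = leftMul j (partialD j g) := fun j g =>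
    (LinearMap.congr_fun (leftMul_partialD (m := m) j j).eq g).symm
  simp only [h, map_sum, sum_inner, inner_sum, inner_leftMul, inner_partialD, hc, neg_neg]

theorem norm_mulX_sq (f : 𝓢(E m, Cl m)) :
    ‖toL2 m (Cl m) (mulX m f)‖ ^ 2 = ∑ j, ‖toL2 m (Cl m) (coordMul j f)‖ ^ 2 := by
  have h : mulX m (mulX m f) = -∑ j, coordMul j (coordMul j f) := by
    simpa using LinearMap.congr_fun (mulX_mul_mulX (m := m)) f
  have h2 : ((‖toL2 m (Cl m) (mulX m f)‖ : ℂ)) ^ 2 =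
      ∑ j, ((‖toL2 m (Cl m) (coordMul j f)‖ : ℂ)) ^ 2 := by
    have := inner_self_eq_norm_sq_to_K (𝕜 := ℂ) (toL2 m (Cl m) (mulX m f))
    refine this.symm.trans ?_
    rw [inner_mulX, h, map_neg, inner_neg_right, neg_neg, map_sum, inner_sum]
    refine Finset.sum_congr rfl fun j _ => ?_
    rw [← inner_coordMul]
    exact inner_self_eq_norm_sq_to_K _
  exact_mod_cast h2

theorem norm_dirac_sq (f : 𝓢(E m, Cl m)) :
    ‖toL2 m (Cl m) (dirac m f)‖ ^ 2 = ∑ j, ‖toL2 m (Cl m) (partialD j f)‖ ^ 2 := by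
  have h : dirac m (dirac m f) = -∑ j, partialD j (partialD j f) := by
    simpa using LinearMap.congr_fun (dirac_mul_dirac (m := m)) f
  have h2 : ((‖toL2 m (Cl m) (dirac m f)‖ : ℂ)) ^ 2 =
      ∑ j, ((‖toL2 m (Cl m) (partialD j f)‖ : ℂ)) ^ 2 := by
    have := inner_self_eq_norm_sq_to_K (𝕜 := ℂ) (toL2 m (Cl m) (dirac m f))
    refine this.symm.trans ?_
    rw [inner_dirac, h, map_neg, inner_neg_right, map_sum, inner_sum, ← Finset.sum_neg_distrib]
    refine Finset.sum_congr rfl fun j _ => ?_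
    rw [← inner_partialD]
    exact inner_self_eq_norm_sq_to_K _
  exact_mod_cast h2

/-- Heisenberg's inequality for the vector variable and the Dirac operator. -/
theorem heisenberg_dirac (f : 𝓢(E m, Cl m)) :
    (m : ℝ) / 2 * ‖toL2 m (Cl m) f‖ ^ 2 ≤
      ‖toL2 m (Cl m) (mulX m f)‖ * ‖toL2 m (Cl m) (dirac m f)‖ := by
  have h := heisenberg f
  rwa [← norm_mulX_sq, ← norm_dirac_sq, Real.sqrt_sq (norm_nonneg _),
    Real.sqrt_sq (norm_nonneg _)] at h

/-- The involution `hconj` as a real continuous linear map. -/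
def hconjL (m : ℕ) : Cl m →L[ℝ] Cl m :=
  LinearMap.toContinuousLinearMap
    { toFun := hconj
      map_add' := fun u v => ext_coord fun A => by simp [coord_hconj, mul_add]
      map_smul' := fun c u => ext_coord fun A => by
        have h : ∀ w : Cl m, coord A (c • w) = (c : ℂ) * coord A w := fun w => by
          rw [← Complex.coe_smul, map_smul, smul_eq_mul]
        simp only [coord_hconj, h, RingHom.id_apply, map_mul, Complex.conj_ofReal]
        ring }

theorem normL2_eq (f : 𝓢(E m, Cl m)) : normL2 f = ‖toL2 m (Cl m) f‖ := by
  have h1 : Integrable fun x => hconj (f x) * f x :=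
    (pairing (mulL m) (postcompCLM (hconjL m) f) f).integrable
  have h2 : innerL2 f f = ⟪toL2 m (Cl m) f, toL2 m (Cl m) f⟫_ℂ := by
    rw [innerL2, inner_toL2]
    have := (scalarPart (m := m)).toContinuousLinearMap.integral_comp_comm h1
    refine this.symm.trans ?_
    simp only [Cl.inner_eq_scalarPart]
    rfl
  rw [normL2, h2, norm_eq_sqrt_re_inner (𝕜 := ℂ)]
  rfl

/-- The lowering operators `x_j + ∂_j`. -/
def lower (j : Fin m) : Module.End ℂ 𝓢(E m, Cl m) := coordMul j + partialD j

/-- The operator `x + ∂` built from the vector variable and the Dirac operator. -/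
def diracLower (m : ℕ) : Module.End ℂ 𝓢(E m, Cl m) := (mulX m).toLinearMap + (dirac m).toLinearMap

/-- The operator `∂ - x`, adjoint to `diracLower`. -/
def diracRaise (m : ℕ) : Module.End ℂ 𝓢(E m, Cl m) := (dirac m).toLinearMap - (mulX m).toLinearMap

theorem diracLower_eq : diracLower m = ∑ j, leftMul j * lower j := by
  simp [diracLower, mulX_eq, dirac_eq, lower, mul_add, Finset.sum_add_distrib]

theorem diracRaise_eq :
    diracRaise m = (∑ j, leftMul j * lower j) - (2 : ℂ) • ∑ j, leftMul j * coordMul j := by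
  rw [← diracLower_eq, ← mulX_eq, diracRaise, diracLower, two_smul]
  abel

theorem inner_diracRaise (f g : 𝓢(E m, Cl m)) :
    ⟪toL2 m (Cl m) (diracRaise m f), toL2 m (Cl m) g⟫_ℂ =
      ⟪toL2 m (Cl m) f, toL2 m (Cl m) (diracLower m g)⟫_ℂ := by
  simp only [diracRaise, diracLower, LinearMap.sub_apply, LinearMap.add_apply, map_sub, map_add,
    inner_sub_left, inner_add_right, ContinuousLinearMap.coe_coe, inner_dirac, inner_mulX]
  ring

theorem diracLower_mul_diracLower : diracLower m * diracLower m = -∑ j, lower j * lower j := by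
  rw [diracLower_eq]
  refine sum_leftMul_mul_self (fun i j => LinearMap.ext fun f => ?_) fun i j => ?_
  · simp only [lower, Module.End.mul_apply, LinearMap.add_apply, map_add, partialD_coordMul,
      coordMul_comm i j, partialD_comm i j]
    by_cases h : i = j
    · subst h; abel
    · simp only [h, Ne.symm h, if_false]; abel
  · exact (leftMul_coordMul i j).add_right (leftMul_partialD i j)

/-- Written through `a_j = x_j + ∂_j`, the oscillator visibly preserves the degree of the polynomial
factor, because `a_j` lowers it and `x_j` raises it by one. -/
theorem hermite_eq : hermite m (Cl m) =
    ∑ j, ((2 : ℂ) • (coordMul j * lower j) - lower j * lower j + 1) := by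
  refine Finset.sum_congr rfl fun j _ => LinearMap.ext fun f => ?_
  simp only [lower, LinearMap.sub_apply, LinearMap.add_apply,
    Module.End.mul_apply, map_add, partialD_coordMul, if_true, Module.End.one_apply, two_smul]
  abel

/-- On the kernel of `x + ∂` the harmonic oscillator is `2 ∑ x_j (x_j + ∂_j) + m`. -/
theorem hermite_apply_of_diracLower_eq_zero {f : 𝓢(E m, Cl m)} (hf : diracLower m f = 0) :
    hermite m (Cl m) f = (2 : ℂ) • ∑ j, coordMul j (lower j f) + (m : ℂ) • f := by
  have h : ∑ j, lower j (lower j f) = 0 := by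
    have := LinearMap.congr_fun (diracLower_mul_diracLower (m := m)) f
    simp only [Module.End.mul_apply, hf, map_zero, LinearMap.neg_apply, LinearMap.sum_apply] at this
    exact neg_eq_zero.mp this.symm
  rw [hermite_eq]
  simp [Finset.sum_add_distrib, h, Finset.smul_sum, Nat.cast_smul_eq_nsmul]

end CliffordOperators

/-! ### Polynomials times the Gaussian: degree filtration and density -/

section PolynomialGaussian

variable {m : ℕ}

theorem hasTemperateGrowth_eval_smul (P : MvPolynomial (Fin m) ℂ) (u : Cl m) :
    (fun x : E m => MvPolynomial.eval (fun j => (x j : ℂ)) P • u).HasTemperateGrowth := by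
  have := hasTemperateGrowth_eval P
  fun_prop

/-- The Schwartz function `P(x) e^{-|x|²/2} u`, bilinear in the polynomial `P` and in `u`. -/
def polyGauss (m : ℕ) : MvPolynomial (Fin m) ℂ →ₗ[ℂ] Cl m →ₗ[ℂ] 𝓢(E m, Cl m) :=
  LinearMap.mk₂ ℂ
    (fun P u => SchwartzMap.bilinLeftCLM (ContinuousLinearMap.lsmul ℝ ℝ)
      (hasTemperateGrowth_eval_smul P u) (gaussian m))
    (fun P P' u => SchwartzMap.ext fun x => by
      simp [SchwartzMap.bilinLeftCLM_apply, add_smul])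
    (fun c P u => SchwartzMap.ext fun x => by
      change gaussian m x • MvPolynomial.eval _ (c • P) • u =
        c • gaussian m x • MvPolynomial.eval _ P • u
      rw [MvPolynomial.smul_eval, mul_smul, smul_comm])
    (fun P u u' => SchwartzMap.ext fun x => by
      simp [SchwartzMap.bilinLeftCLM_apply])
    (fun c P u => SchwartzMap.ext fun x => by
      change gaussian m x • MvPolynomial.eval _ P • c • u =
        c • gaussian m x • MvPolynomial.eval _ P • u
      rw [smul_comm _ c u, smul_comm _ c])

theorem polyGauss_apply (P : MvPolynomial (Fin m) ℂ) (u : Cl m) (x : E m) :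
    polyGauss m P u x = gaussian m x • MvPolynomial.eval (fun j => (x j : ℂ)) P • u := rfl

theorem leftMul_polyGauss (j : Fin m) (P : MvPolynomial (Fin m) ℂ) (u : Cl m) :
    leftMul j (polyGauss m P u) = polyGauss m P (e j * u) := by
  ext x
  simp [leftMul_apply, polyGauss_apply]

theorem coordMul_polyGauss (j : Fin m) (P : MvPolynomial (Fin m) ℂ) (u : Cl m) :
    coordMul j (polyGauss m P u) = polyGauss m (P * MvPolynomial.X j) u := by
  ext x
  simp only [coordMul_apply, polyGauss_apply, map_mul, MvPolynomial.eval_X]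
  rw [smul_comm, smul_smul, mul_comm]

theorem lower_coordMul (i j : Fin m) (f : 𝓢(E m, Cl m)) :
    lower i (coordMul j f) = coordMul j (lower i f) + if i = j then f else 0 := by
  simp only [lower, LinearMap.add_apply, partialD_coordMul, coordMul_comm i j, map_add]
  abel

theorem lower_polyGauss_C (j : Fin m) (a : ℂ) (u : Cl m) :
    lower j (polyGauss m (MvPolynomial.C a) u) = 0 := by
  ext x
  have h1 : HasFDerivAt (gaussian m : E m → ℝ)
      (Real.exp (-‖x‖ ^ 2 / 2) • (-(innerSL ℝ x))) x := by
    have h2 : HasFDerivAt (fun y : E m => -‖y‖ ^ 2 / 2) (-(innerSL ℝ x)) x := by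
      have := ((hasStrictFDerivAt_norm_sq x).hasFDerivAt.neg).const_mul (2 : ℝ)⁻¹
      refine (this.congr_fderiv ?_).congr_of_eventuallyEq
        (Filter.Eventually.of_forall fun y => by simp only [Pi.neg_apply]; ring)
      ext v; simp
    exact h2.exp
  have h3 := h1.smul_const (a • u)
  have h4 : (polyGauss m (MvPolynomial.C a) u : E m → Cl m) = fun y => gaussian m y • a • u :=
    funext fun y => by simp [polyGauss_apply]
  simp only [lower, LinearMap.add_apply, _root_.add_apply, coordMul_apply, partialD_apply]
  rw [h4, h3.fderiv]
  simp [gaussian_apply, EuclideanSpace.inner_single_right, mul_smul, smul_comm (x j)]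

/-- Conjugation by the Gaussian turns `x_j + ∂_j` into `∂_j`; the induction on `P` uses only that
the Gaussian is annihilated and that `[x_i + ∂_i, x_j] = δ_ij`. -/
theorem lower_polyGauss (j : Fin m) (P : MvPolynomial (Fin m) ℂ) (u : Cl m) :
    lower j (polyGauss m P u) = polyGauss m (MvPolynomial.pderiv j P) u := by
  induction P using MvPolynomial.induction_on with
  | C a => simp [lower_polyGauss_C]
  | add P P' h h' => simp [h, h']
  | mul_X P i h =>
    rw [← coordMul_polyGauss, lower_coordMul, h, coordMul_polyGauss, MvPolynomial.pderiv_mul,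
      map_add, LinearMap.add_apply]
    by_cases hij : j = i
    · subst hij; simp
    · simp [hij, MvPolynomial.pderiv_X_of_ne (Ne.symm hij)]

/-- The span of the products of the Gaussian with polynomials of degree less than `n`. -/
def gaussSpan (m n : ℕ) : Submodule ℂ 𝓢(E m, Cl m) :=
  Submodule.span ℂ ((fun q : (Fin m →₀ ℕ) × Finset (Fin m) =>
    polyGauss m (MvPolynomial.monomial q.1 1) (blade q.2)) '' {q | q.1.degree < n})

instance (n : ℕ) : FiniteDimensional ℂ (gaussSpan m n) := by
  refine FiniteDimensional.span_of_finite ℂ (Set.Finite.image _ ?_)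
  refine ((Finsupp.finite_of_degree_le (σ := Fin m) n).prod Set.finite_univ).subset fun q hq => ?_
  exact ⟨Nat.le_of_lt hq, Set.mem_univ _⟩

theorem polyGauss_monomial_mem {n : ℕ} {s : Fin m →₀ ℕ} (hs : s.degree < n) (a : ℂ) (u : Cl m) :
    polyGauss m (MvPolynomial.monomial s a) u ∈ gaussSpan m n := by
  have h : MvPolynomial.monomial s a = a • MvPolynomial.monomial s (1 : ℂ) := by
    simp [MvPolynomial.smul_monomial]
  rw [h, map_smul, LinearMap.smul_apply, eq_sum_blade u, map_sum]
  refine Submodule.smul_mem _ _ (Submodule.sum_mem _ fun A _ => ?_)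
  rw [map_smul]
  exact Submodule.smul_mem _ _ (Submodule.subset_span ⟨(s, A), hs, rfl⟩)

theorem gaussSpan_induction {n : ℕ} {W : Submodule ℂ 𝓢(E m, Cl m)}
    {B : Module.End ℂ 𝓢(E m, Cl m)}
    (h : ∀ (s : Fin m →₀ ℕ) (A : Finset (Fin m)), s.degree < n →
      B (polyGauss m (MvPolynomial.monomial s 1) (blade A)) ∈ W)
    {f : 𝓢(E m, Cl m)} (hf : f ∈ gaussSpan m n) : B f ∈ W := by
  have : gaussSpan m n ≤ W.comap B := by
    rw [gaussSpan, Submodule.span_le]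
    rintro _ ⟨⟨s, A⟩, hs, rfl⟩
    exact h s A hs
  exact this hf

theorem gaussSpan_zero : gaussSpan m 0 = ⊥ := by
  simp [gaussSpan]

theorem gaussSpan_mono {n n' : ℕ} (h : n ≤ n') : gaussSpan m n ≤ gaussSpan m n' :=
  Submodule.span_mono (Set.image_mono fun _ hq => lt_of_lt_of_le hq h)

theorem leftMul_mem_gaussSpan {n : ℕ} (j : Fin m) {f : 𝓢(E m, Cl m)} (hf : f ∈ gaussSpan m n) :
    leftMul j f ∈ gaussSpan m n :=
  gaussSpan_induction (fun s A hs => by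
    rw [leftMul_polyGauss]; exact polyGauss_monomial_mem hs _ _) hf

theorem coordMul_mem_gaussSpan {n : ℕ} (j : Fin m) {f : 𝓢(E m, Cl m)} (hf : f ∈ gaussSpan m n) :
    coordMul j f ∈ gaussSpan m (n + 1) :=
  gaussSpan_induction (fun s A hs => by
    rw [coordMul_polyGauss, ← pow_one (MvPolynomial.X j), ← MvPolynomial.monomial_add_single]
    refine polyGauss_monomial_mem ?_ _ _
    rw [map_add, Finsupp.degree_single]
    omega) hf

theorem lower_mem_gaussSpan {n : ℕ} (j : Fin m) {f : 𝓢(E m, Cl m)}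
    (hf : f ∈ gaussSpan m (n + 1)) : lower j f ∈ gaussSpan m n :=
  gaussSpan_induction (fun s A hs => by
    rw [lower_polyGauss, MvPolynomial.pderiv_monomial]
    by_cases h : s j = 0
    · simp [h]
    · refine polyGauss_monomial_mem ?_ _ _
      have h1 : s - Finsupp.single j 1 + Finsupp.single j 1 = s := by
        refine tsub_add_cancel_of_le ?_
        rw [Finsupp.single_le_iff]; omega
      have h2 := congrArg Finsupp.degree h1
      rw [map_add, Finsupp.degree_single] at h2
      omega) hf

theorem diracLower_mem_gaussSpan {n : ℕ} {f : 𝓢(E m, Cl m)} (hf : f ∈ gaussSpan m (n + 1)) :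
    diracLower m f ∈ gaussSpan m n := by
  rw [diracLower_eq, LinearMap.sum_apply]
  exact Submodule.sum_mem _ fun j _ => leftMul_mem_gaussSpan j (lower_mem_gaussSpan j hf)

theorem diracRaise_mem_gaussSpan {n : ℕ} {f : 𝓢(E m, Cl m)} (hf : f ∈ gaussSpan m n) :
    diracRaise m f ∈ gaussSpan m (n + 1) := by
  rw [diracRaise_eq, LinearMap.sub_apply, LinearMap.smul_apply, LinearMap.sum_apply,
    LinearMap.sum_apply]
  refine Submodule.sub_mem _ (Submodule.sum_mem _ fun j _ => ?_)
    (Submodule.smul_mem _ _ (Submodule.sum_mem _ fun j _ => ?_))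
  · exact leftMul_mem_gaussSpan j (gaussSpan_mono (Nat.le_succ n)
      (lower_mem_gaussSpan j (gaussSpan_mono (Nat.le_succ n) hf)))
  · exact leftMul_mem_gaussSpan j (coordMul_mem_gaussSpan j hf)

theorem hermite_mem_gaussSpan {n : ℕ} {f : 𝓢(E m, Cl m)} (hf : f ∈ gaussSpan m n) :
    hermite m (Cl m) f ∈ gaussSpan m n := by
  cases n with
  | zero =>
    rw [gaussSpan_zero, Submodule.mem_bot] at hf ⊢
    rw [hf, map_zero]
  | succ n =>
    rw [hermite_eq, LinearMap.sum_apply]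
    refine Submodule.sum_mem _ fun j _ => ?_
    have h1 := lower_mem_gaussSpan j hf
    exact Submodule.add_mem _ (Submodule.sub_mem _
      (Submodule.smul_mem _ _ (coordMul_mem_gaussSpan j h1))
      (gaussSpan_mono (Nat.le_succ n) (lower_mem_gaussSpan j
        (gaussSpan_mono (Nat.le_succ n) h1)))) hf

/-- The oscillator is injective because `‖g‖ ≤ ‖H g‖`, and an injective endomorphism of a
finite-dimensional space is surjective. -/
theorem exists_hermite_eq (hm : 1 ≤ m) {n : ℕ} {f : 𝓢(E m, Cl m)} (hf : f ∈ gaussSpan m n) :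
    ∃ g ∈ gaussSpan m n, hermite m (Cl m) g = f := by
  set R : gaussSpan m n →ₗ[ℂ] gaussSpan m n :=
    (hermite m (Cl m)).restrict fun _ h => hermite_mem_gaussSpan h with hR
  have hinj : Function.Injective R := by
    rw [← LinearMap.ker_eq_bot, LinearMap.ker_eq_bot']
    intro g hg
    have h1 : hermite m (Cl m) g = 0 := congrArg Subtype.val hg
    have h2 := norm_le_norm_hermite hm (g : 𝓢(E m, Cl m))
    rw [h1, map_zero, norm_zero, norm_le_zero_iff] at h2
    exact Subtype.ext (toL2_injective (h2.trans (map_zero _).symm))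
  obtain ⟨g, hg⟩ := (LinearMap.injective_iff_surjective.mp hinj) ⟨f, hf⟩
  exact ⟨g, g.2, congrArg Subtype.val hg⟩

theorem exists_hermite_pow_eq (hm : 1 ≤ m) (N : ℕ) {n : ℕ} {f : 𝓢(E m, Cl m)}
    (hf : f ∈ gaussSpan m n) : ∃ g ∈ gaussSpan m n, (hermite m (Cl m) ^ N) g = f := by
  induction N with
  | zero => exact ⟨f, hf, rfl⟩
  | succ N ih =>
    obtain ⟨g, hg, rfl⟩ := ih
    obtain ⟨g', hg', rfl⟩ := exists_hermite_eq hm hg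
    exact ⟨g', hg', by rw [pow_succ, Module.End.mul_apply]⟩

theorem monotone_gaussSpan : Monotone (gaussSpan m) := fun _ _ h => gaussSpan_mono h

theorem polyGauss_mem_iSup (P : MvPolynomial (Fin m) ℂ) (u : Cl m) :
    polyGauss m P u ∈ ⨆ n, gaussSpan m n := by
  rw [MvPolynomial.as_sum P, map_sum, LinearMap.sum_apply]
  refine Submodule.sum_mem _ fun s _ => ?_
  exact Submodule.mem_iSup_of_mem _ (polyGauss_monomial_mem (Nat.lt_succ_self _) _ _)

/-- The products of the Gaussian with polynomials are dense in `L²`. -/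
theorem exists_gaussSpan_norm_sub_lt (f : 𝓢(E m, Cl m)) {ε : ℝ} (hε : 0 < ε) :
    ∃ n, ∃ g ∈ gaussSpan m n, ‖toL2 m (Cl m) (f - g)‖ < ε := by
  set W : Submodule ℂ (Lp (Cl m) 2 (volume : Measure (E m))) :=
    (⨆ n, gaussSpan m n).map (toL2 m (Cl m)).toLinearMap with hW
  have hd : W.topologicalClosure = ⊤ := by
    rw [Submodule.topologicalClosure_eq_top_iff, Submodule.eq_bot_iff]
    intro h hh
    have hz : (h : E m → Cl m) =ᵐ[volume] 0 := by
      refine ae_eq_zero_of_forall_integral_polynomial_gaussian (Lp.memLp h) fun P => ?_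
      by_cases hi : Integrable fun x : E m =>
        MvPolynomial.eval (fun j => (x j : ℂ)) P • gaussian m x • h x
      swap
      -- The integral of a non-integrable function is zero by convention, so integrability need not
      -- be established here.
      · exact integral_undef hi
      refine ext_inner_left ℂ fun u => ?_
      -- The coefficients of `P` are conjugated because the inner product is conjugate-linear in its
      -- first argument.
      rw [← integral_inner hi, inner_zero_right,
        ← hh _ ⟨_, polyGauss_mem_iSup (MvPolynomial.map (starRingEnd ℂ) P) u, rfl⟩,
        L2.inner_def]
      refine integral_congr_ae ?_
      filter_upwards [(polyGauss m (MvPolynomial.map (starRingEnd ℂ) P) u).coeFn_toLp 2 volume]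
        with x hx
      have hx' : (toL2 m (Cl m)).toLinearMap
        (polyGauss m (MvPolynomial.map (starRingEnd ℂ) P) u) x = _ := hx
      have hc : MvPolynomial.eval (fun j => (x j : ℂ)) (MvPolynomial.map (starRingEnd ℂ) P) =
          starRingEnd ℂ (MvPolynomial.eval (fun j => (x j : ℂ)) P) := by
        rw [MvPolynomial.eval_map, ← MvPolynomial.eval₂_id, MvPolynomial.hom_eval₂]
        simp
      rw [hx', polyGauss_apply, hc, ← Complex.coe_smul, ← Complex.coe_smul]
      simp only [inner_smul_left, inner_smul_right, Complex.conj_conj, Complex.conj_ofReal]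
      ring
    exact (Lp.eq_zero_iff_ae_eq_zero).mpr hz
  have hf : toL2 m (Cl m) f ∈ W.topologicalClosure := by rw [hd]; trivial
  obtain ⟨w, hw, hlt⟩ := Metric.mem_closure_iff.mp hf ε hε
  obtain ⟨g, hg, rfl⟩ := hw
  obtain ⟨n, hn⟩ := (Submodule.mem_iSup_of_directed _ monotone_gaussSpan.directed_le).mp hg
  refine ⟨n, g, hn, ?_⟩
  rw [map_sub, ← dist_eq_norm]
  exact hlt

end PolynomialGaussian

/-! ### The kernel of `x + ∂` and the spherical monogenics -/

section Monogenic

variable {m : ℕ}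

theorem hasLineDerivAt_eval (P : MvPolynomial (Fin m) ℂ) (j : Fin m) (x : E m) :
    HasLineDerivAt ℝ (fun y : E m => MvPolynomial.eval (fun i => (y i : ℂ)) P)
      (MvPolynomial.eval (fun i => (x i : ℂ)) (MvPolynomial.pderiv j P)) x
      (EuclideanSpace.single j 1) := by
  induction P using MvPolynomial.induction_on with
  | C a => simpa [HasLineDerivAt] using hasDerivAt_const (0 : ℝ) a
  | add P P' h h' => simpa [HasLineDerivAt] using HasDerivAt.fun_add h h'
  | mul_X P i h =>
    have h1 : HasLineDerivAt ℝ (fun y : E m => (y i : ℂ)) (if j = i then 1 else 0) x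
        (EuclideanSpace.single j 1) := by
      have := ((Complex.ofRealCLM.comp (EuclideanSpace.proj i : E m →L[ℝ] ℝ)).hasFDerivAt
        (x := x)).hasLineDerivAt (EuclideanSpace.single j 1)
      refine this.congr_deriv ?_
      by_cases hij : j = i
      · subst hij; simp
      · simp [hij, Ne.symm hij]
    have h2 := HasDerivAt.mul h h1
    simp only [zero_smul, add_zero] at h2
    simp only [HasLineDerivAt, map_mul, MvPolynomial.eval_X]
    refine h2.congr_deriv ?_
    rw [MvPolynomial.pderiv_mul]
    by_cases hij : j = i
    · subst hij; simp
    · simp [hij, MvPolynomial.pderiv_X_of_ne (Ne.symm hij)]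

/-- The Clifford-valued polynomial function with given coordinates. -/
def polyFun (P : Finset (Fin m) → MvPolynomial (Fin m) ℂ) (x : E m) : Cl m :=
  ∑ A, MvPolynomial.eval (fun i => (x i : ℂ)) (P A) • blade A

/-- The coordinates of the Dirac operator applied to a Clifford-valued polynomial. -/
def diracPoly (P : Finset (Fin m) → MvPolynomial (Fin m) ℂ) (B : Finset (Fin m)) :
    MvPolynomial (Fin m) ℂ :=
  ∑ j, ∑ A, MvPolynomial.C (coord B (e j * blade A)) * MvPolynomial.pderiv j (P A)

theorem diracFun_polyFun_eq_sum (P : Finset (Fin m) → MvPolynomial (Fin m) ℂ) (x : E m) :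
    diracFun (polyFun P) x = ∑ j, ∑ A,
      MvPolynomial.eval (fun i => (x i : ℂ)) (MvPolynomial.pderiv j (P A)) • (e j * blade A) := by
  refine Finset.sum_congr rfl fun j _ => ?_
  have h : HasLineDerivAt ℝ (polyFun P) (∑ A, MvPolynomial.eval (fun i => (x i : ℂ))
      (MvPolynomial.pderiv j (P A)) • blade A) x (EuclideanSpace.single j 1) :=
    HasDerivAt.fun_sum fun A _ => HasDerivAt.smul_const (hasLineDerivAt_eval (P A) j x) (blade A)
  rw [h.lineDeriv, Finset.mul_sum]
  simp

theorem coord_diracFun_polyFun (P : Finset (Fin m) → MvPolynomial (Fin m) ℂ) (x : E m)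
    (B : Finset (Fin m)) : coord B (diracFun (polyFun P) x) =
      MvPolynomial.eval (fun i => (x i : ℂ)) (diracPoly P B) := by
  simp [diracFun_polyFun_eq_sum, diracPoly, mul_comm]

/-- A complex polynomial that vanishes at all real points is zero, since the reals are an infinite
subset of `ℂ`. This turns a pointwise equation into one that can be split by degree. -/
theorem diracFun_polyFun_eq_zero_iff (P : Finset (Fin m) → MvPolynomial (Fin m) ℂ) :
    (∀ x, diracFun (polyFun P) x = 0) ↔ diracPoly P = 0 := by
  constructor
  · intro h
    funext B
    refine MvPolynomial.funext_set (fun _ => Set.range ((↑) : ℝ → ℂ))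
      (fun _ => Set.infinite_range_of_injective Complex.ofReal_injective) fun z hz => ?_
    choose y hy using fun i => hz i (Set.mem_univ i)
    have := coord_diracFun_polyFun P (WithLp.toLp 2 y) B
    rw [h, map_zero] at this
    simpa [hy] using this.symm
  · intro h x
    exact ext_coord fun B => by rw [coord_diracFun_polyFun, h]; simp

theorem homogeneousComponent_pderiv (k : ℕ) (j : Fin m) (P : MvPolynomial (Fin m) ℂ) :
    MvPolynomial.homogeneousComponent k (MvPolynomial.pderiv j P) =
      MvPolynomial.pderiv j (MvPolynomial.homogeneousComponent (k + 1) P) := by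
  ext d
  simp only [MvPolynomial.coeff_homogeneousComponent, MvPolynomial.coeff_pderiv, map_add,
    Finsupp.degree_single, Nat.add_right_cancel_iff]
  split_ifs <;> simp

/-- The Dirac operator lowers the degree by exactly one, so its kernel is graded; in degree zero the
component is constant. -/
theorem diracPoly_homogeneousComponent {P : Finset (Fin m) → MvPolynomial (Fin m) ℂ}
    (h : diracPoly P = 0) (k : ℕ) :
    diracPoly (fun A => MvPolynomial.homogeneousComponent k (P A)) = 0 := by
  funext B
  cases k with
  | zero => simp [diracPoly, MvPolynomial.homogeneousComponent_zero]
  | succ k =>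
    have := congrArg (MvPolynomial.homogeneousComponent k) (congrFun h B)
    simpa [diracPoly, MvPolynomial.homogeneousComponent_C_mul, homogeneousComponent_pderiv] using this

theorem coord_polyFun (P : Finset (Fin m) → MvPolynomial (Fin m) ℂ) (x : E m)
    (A : Finset (Fin m)) :
    coord A (polyFun P x) = MvPolynomial.eval (fun i => (x i : ℂ)) (P A) := by
  simp [polyFun, coord_blade]

theorem sum_polyGauss_apply (P : Finset (Fin m) → MvPolynomial (Fin m) ℂ) (x : E m) :
    (∑ A, polyGauss m (P A) (blade A)) x = gaussian m x • polyFun P x := by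
  simp [polyGauss_apply, polyFun, Finset.smul_sum]

theorem diracLower_sum_polyGauss_apply (P : Finset (Fin m) → MvPolynomial (Fin m) ℂ) (x : E m) :
    diracLower m (∑ A, polyGauss m (P A) (blade A)) x = gaussian m x • diracFun (polyFun P) x := by
  simp only [diracLower_eq, LinearMap.sum_apply, Module.End.mul_apply, map_sum, lower_polyGauss,
    leftMul_polyGauss, _root_.sum_apply, polyGauss_apply, diracFun_polyFun_eq_sum,
    Finset.smul_sum]
  exact Finset.sum_comm

theorem diracLower_sum_polyGauss_eq_zero_iff
    (P : Finset (Fin m) → MvPolynomial (Fin m) ℂ) :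
    diracLower m (∑ A, polyGauss m (P A) (blade A)) = 0 ↔ diracPoly P = 0 := by
  rw [← diracFun_polyFun_eq_zero_iff]
  constructor
  · intro h x
    have := diracLower_sum_polyGauss_apply P x
    rw [h] at this
    exact (smul_eq_zero.mp this.symm).resolve_left (Real.exp_pos _).ne'
  · intro h
    ext x
    rw [diracLower_sum_polyGauss_apply, h, smul_zero]
    rfl

/-- The value is the quotient of `Γ(m/2 + k)` by itself; `m ≥ 1` keeps the argument positive also
for `k = 0`. -/
theorem laguerre_zero (hm : 1 ≤ m) (k : ℕ) (t : ℝ) : laguerre 0 (m / 2 + k - 1) t = 1 := by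
  have h : (0 : ℝ) < m / 2 + k := by
    have : (1 : ℝ) ≤ m := by exact_mod_cast hm
    positivity
  simp [laguerre, (Real.Gamma_pos_of_pos h).ne']

theorem psi_zero_apply (hm : 1 ≤ m) (k : ℕ) (M : sphericalMonogenics m k) (x : E m) :
    psi 0 k M x = gaussian m x • (M : E m → Cl m) x := by
  have := psi_apply_even 0 k M x
  rw [laguerre_zero hm] at this
  simpa [gaussian_apply] using this

/-- The linear map `M ↦ M e^{-|x|²/2}`. -/
def psiZero (hm : 1 ≤ m) (k : ℕ) : sphericalMonogenics m k →ₗ[ℂ] 𝓢(E m, Cl m) where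
  toFun := psi 0 k
  map_add' M M' := SchwartzMap.ext fun x => by simp [psi_zero_apply hm]
  map_smul' c M := SchwartzMap.ext fun x => by
    rw [_root_.smul_apply, psi_zero_apply hm, psi_zero_apply hm]
    exact smul_comm (gaussian m x) c ((M : E m → Cl m) x)

theorem psiZero_eq_sum (hm : 1 ≤ m) (k : ℕ) (M : sphericalMonogenics m k)
    {P : Finset (Fin m) → MvPolynomial (Fin m) ℂ} (hP : (M : E m → Cl m) = polyFun P) :
    psiZero hm k M = ∑ A, polyGauss m (P A) (blade A) := by
  ext x
  rw [sum_polyGauss_apply, ← hP]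
  exact psi_zero_apply hm k M x

theorem exists_polyFun_eq {k : ℕ} (M : sphericalMonogenics m k) :
    ∃ P : Finset (Fin m) → MvPolynomial (Fin m) ℂ,
      (∀ A, (P A).IsHomogeneous k) ∧ (M : E m → Cl m) = polyFun P := by
  choose P hP hP' using M.2.1
  exact ⟨P, hP, funext fun x => ext_coord fun A => by rw [coord_polyFun, hP']⟩

theorem diracLower_psiZero (hm : 1 ≤ m) (k : ℕ) (M : sphericalMonogenics m k) :
    diracLower m (psiZero hm k M) = 0 := by
  obtain ⟨P, -, hP⟩ := exists_polyFun_eq M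
  rw [psiZero_eq_sum hm k M hP, diracLower_sum_polyGauss_eq_zero_iff,
    ← diracFun_polyFun_eq_zero_iff, ← hP]
  exact M.2.2

/-- On the kernel of `x + ∂` only `2 ∑ x_j (x_j + ∂_j) + m` survives, and this acts on the
polynomial factor as twice the Euler operator plus `m`. Distinct degrees thus have distinct
eigenvalues, which gives their orthogonality. -/
theorem hermite_psiZero (hm : 1 ≤ m) (k : ℕ) (M : sphericalMonogenics m k) :
    hermite m (Cl m) (psiZero hm k M) = ((m + 2 * k : ℝ) : ℂ) • psiZero hm k M := by
  rw [hermite_apply_of_diracLower_eq_zero (diracLower_psiZero hm k M)]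
  have h : ∑ j, coordMul j (lower j (psiZero hm k M)) = (k : ℂ) • psiZero hm k M := by
    obtain ⟨P, hk, hP⟩ := exists_polyFun_eq M
    rw [psiZero_eq_sum hm k M hP]
    simp only [map_sum, lower_polyGauss, coordMul_polyGauss]
    rw [Finset.sum_comm, Finset.smul_sum]
    refine Finset.sum_congr rfl fun A _ => ?_
    have := (hk A).sum_X_mul_pderiv
    rw [← LinearMap.sum_apply, ← map_sum, ← LinearMap.smul_apply, ← map_smul]
    congr 2
    simp only [mul_comm _ (MvPolynomial.X _)]
    rw [this, Nat.cast_smul_eq_nsmul]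
  rw [h, smul_smul, ← add_smul]
  congr 1
  push_cast; ring

/-- Spherical monogenics of different degrees are orthogonal. -/
theorem inner_psiZero (hm : 1 ≤ m) {k l : ℕ} (hkl : k ≠ l) (M : sphericalMonogenics m k)
    (M' : sphericalMonogenics m l) :
    ⟪toL2 m (Cl m) (psiZero hm k M), toL2 m (Cl m) (psiZero hm l M')⟫_ℂ = 0 := by
  have h := inner_hermite_left (psiZero hm k M) (psiZero hm l M')
  rw [hermite_psiZero, hermite_psiZero, map_smul, map_smul, inner_smul_left, inner_smul_right,
    Complex.conj_ofReal, ← sub_eq_zero, ← sub_mul] at h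
  refine (mul_eq_zero.mp h).resolve_left fun h0 => hkl ?_
  have : (k : ℂ) = l := by push_cast at h0; linear_combination h0 / 2
  exact_mod_cast this

theorem exists_sum_polyGauss_eq {n : ℕ} {f : 𝓢(E m, Cl m)} (hf : f ∈ gaussSpan m n) :
    ∃ P : Finset (Fin m) → MvPolynomial (Fin m) ℂ, f = ∑ A, polyGauss m (P A) (blade A) := by
  induction hf using Submodule.span_induction with
  | mem f hf =>
    obtain ⟨⟨s, A⟩, -, rfl⟩ := hf
    refine ⟨Pi.single A (MvPolynomial.monomial s 1), ?_⟩
    rw [Finset.sum_eq_single A] <;> simp +contextual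
  | zero => exact ⟨0, by simp⟩
  | add f g _ _ hf hg =>
    obtain ⟨P, rfl⟩ := hf
    obtain ⟨P', rfl⟩ := hg
    exact ⟨P + P', by simp [Finset.sum_add_distrib]⟩
  | smul c f _ hf =>
    obtain ⟨P, rfl⟩ := hf
    exact ⟨c • P, by simp [Finset.smul_sum]⟩

/-- A polynomial times the Gaussian in the kernel of `x + ∂` is a sum of spherical monogenics
times the Gaussian. -/
theorem exists_sum_psiZero_eq (hm : 1 ≤ m) {n : ℕ} {f : 𝓢(E m, Cl m)} (hf : f ∈ gaussSpan m n)
    (h0 : diracLower m f = 0) : ∃ (N : ℕ) (M : ∀ k, sphericalMonogenics m k),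
      ∀ N' ≥ N, f = ∑ k ∈ Finset.range N', psiZero hm k (M k) := by
  obtain ⟨P, rfl⟩ := exists_sum_polyGauss_eq hf
  rw [diracLower_sum_polyGauss_eq_zero_iff] at h0
  set Pk : ℕ → Finset (Fin m) → MvPolynomial (Fin m) ℂ := fun k A =>
    MvPolynomial.homogeneousComponent k (P A) with hPk
  have hM : ∀ k, polyFun (Pk k) ∈ sphericalMonogenics m k := fun k =>
    ⟨fun A => ⟨Pk k A, MvPolynomial.homogeneousComponent_isHomogeneous k (P A),
      fun x => coord_polyFun (Pk k) x A⟩,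
      (diracFun_polyFun_eq_zero_iff _).mpr (diracPoly_homogeneousComponent h0 k)⟩
  -- Any bound above all coordinate degrees works. Stating the expansion for every larger `N'` lets
  -- two functions share one summation range.
  refine ⟨(Finset.univ.sup fun A => (P A).totalDegree) + 1, fun k => ⟨polyFun (Pk k), hM k⟩,
    fun N' hN => ?_⟩
  have h1 : ∀ A, P A = ∑ k ∈ Finset.range N', Pk k A := fun A => by
    have hA : (P A).totalDegree + 1 ≤ N' := by
      have := Finset.le_sup (f := fun A => (P A).totalDegree) (Finset.mem_univ A)
      omega
    conv_lhs => rw [← MvPolynomial.sum_homogeneousComponent (P A)]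
    refine Finset.sum_subset (Finset.range_mono hA) fun k _ hk => ?_
    exact MvPolynomial.homogeneousComponent_eq_zero _ _ (by simpa using hk)
  simp only [fun k => psiZero_eq_sum hm k ⟨polyFun (Pk k), hM k⟩ (P := Pk k) rfl]
  rw [Finset.sum_comm]
  refine Finset.sum_congr rfl fun A _ => ?_
  conv_lhs => rw [h1 A]
  rw [map_sum, LinearMap.sum_apply]

end Monogenic

/-! ### Isometry on polynomials times the Gaussian, and contractivity -/

section Isometry

variable {m : ℕ}

/-- Modulo the image of `∂ - x`, every product of a polynomial and the Gaussian lies in the kernel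
of the adjoint `x + ∂`. -/
theorem exists_diracLower_sub_diracRaise_eq_zero {n : ℕ} {f : 𝓢(E m, Cl m)}
    (hf : f ∈ gaussSpan m (n + 1)) :
    ∃ u ∈ gaussSpan m n, diracLower m (f - diracRaise m u) = 0 := by
  -- This image is finite-dimensional, so the orthogonal projection onto it exists.
  set U := (gaussSpan m n).map ((toL2 m (Cl m)).toLinearMap ∘ₗ diracRaise m) with hU
  have : FiniteDimensional ℂ U := inferInstance
  obtain ⟨p, hp, q, hq, hpq⟩ := U.exists_add_mem_mem_orthogonal (toL2 m (Cl m) f)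
  obtain ⟨u, hu, rfl⟩ := hp
  refine ⟨u, hu, toL2_injective ?_⟩
  set w := f - diracRaise m u with hw
  have hwq : toL2 m (Cl m) w = q := by
    rw [hw, map_sub, hpq]; simp
  have hmem : diracLower m w ∈ gaussSpan m n :=
    diracLower_mem_gaussSpan (Submodule.sub_mem _ hf (diracRaise_mem_gaussSpan hu))
  -- With `v = (x + ∂)w` of degree below `n`, the adjoint relation gives `‖v‖² = ⟨(∂ - x)v, w⟩`,
  -- which vanishes as `w` is orthogonal to the image of `∂ - x`.
  rw [map_zero, ← inner_self_eq_zero (𝕜 := ℂ), ← inner_diracRaise, hwq]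
  exact hq _ ⟨_, hmem, rfl⟩

/-- An operator with the Clifford-Helmholtz relations that acts on each `𝓜ₖ e^{-|x|²/2}` as
a unimodular scalar preserves the inner product of products of polynomials and the Gaussian. -/
theorem inner_map_map_of_mem_gaussSpan (hm : 1 ≤ m) (T : 𝓢(E m, Cl m) →L[ℂ] 𝓢(E m, Cl m))
    (hI₁ : ∀ f, T (dirac m f) = -Complex.I • mulX m (T f))
    (hI₂ : ∀ f, T (mulX m f) = -Complex.I • dirac m (T f))
    (c : ℕ → ℂ) (hc : ∀ k M, T (psiZero hm k M) = c k • psiZero hm k M)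
    (hc1 : ∀ k (M : sphericalMonogenics m k), psiZero hm k M ≠ 0 → ‖c k‖ = 1) {n : ℕ}
    {f g : 𝓢(E m, Cl m)} (hf : f ∈ gaussSpan m n) (hg : g ∈ gaussSpan m n) :
    ⟪toL2 m (Cl m) (T f), toL2 m (Cl m) (T g)⟫_ℂ = ⟪toL2 m (Cl m) f, toL2 m (Cl m) g⟫_ℂ := by
  have hR : ∀ f, T (diracRaise m f) = Complex.I • diracRaise m (T f) := fun f => by
    simp only [diracRaise, LinearMap.sub_apply, ContinuousLinearMap.coe_coe, map_sub, hI₁, hI₂,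
      smul_sub, neg_smul]
    abel
  have hL : ∀ f, T (diracLower m f) = -Complex.I • diracLower m (T f) := fun f => by
    simp only [diracLower, LinearMap.add_apply, ContinuousLinearMap.coe_coe, map_add, hI₁, hI₂,
      smul_add]
    abel
  have hII : Complex.I * Complex.I = -1 := Complex.I_mul_I
  induction n generalizing f g with
  | zero =>
    rw [gaussSpan_zero, Submodule.mem_bot] at hf
    simp [hf]
  | succ n ih =>
    obtain ⟨u, hu, hw⟩ := exists_diracLower_sub_diracRaise_eq_zero hf
    obtain ⟨u', hu', hw'⟩ := exists_diracLower_sub_diracRaise_eq_zero hg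
    set w := f - diracRaise m u with hwdef
    set w' := g - diracRaise m u' with hwdef'
    have hwm : w ∈ gaussSpan m (n + 1) := Submodule.sub_mem _ hf (diracRaise_mem_gaussSpan hu)
    have hwm' : w' ∈ gaussSpan m (n + 1) := Submodule.sub_mem _ hg (diracRaise_mem_gaussSpan hu')
    have hLT : ∀ w, diracLower m w = 0 → diracLower m (T w) = 0 := fun w h => by
      have := hL w
      rw [h, map_zero] at this
      exact (smul_eq_zero.mp this.symm).resolve_left (by simp)
    have cross : ∀ u w, diracLower m w = 0 →
        ⟪toL2 m (Cl m) (diracRaise m u), toL2 m (Cl m) w⟫_ℂ = 0 := fun u w h => by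
      rw [inner_diracRaise, h, map_zero, inner_zero_right]
    have crossT : ∀ u w, diracLower m w = 0 →
        ⟪toL2 m (Cl m) (T (diracRaise m u)), toL2 m (Cl m) (T w)⟫_ℂ = 0 := fun u w h => by
      rw [hR, map_smul, inner_smul_left, cross _ _ (hLT w h), mul_zero]
    -- Moving one `∂ - x` across leaves `u` paired with `(x + ∂)(∂ - x)u'`, both of degree below
    -- `n`. The phases `-i` and `i` cancel, so `T` commutes with this product. The induction runs on
    -- inner products rather than norms because the two entries differ.
    have hraise : ⟪toL2 m (Cl m) (T (diracRaise m u)), toL2 m (Cl m) (T (diracRaise m u'))⟫_ℂ =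
        ⟪toL2 m (Cl m) (diracRaise m u), toL2 m (Cl m) (diracRaise m u')⟫_ℂ := by
      have h1 : T (diracLower m (diracRaise m u')) = diracLower m (diracRaise m (T u')) := by
        rw [hL, hR, map_smul, smul_smul, neg_mul, hII, neg_neg, one_smul]
      rw [inner_diracRaise u (diracRaise m u'),
        ← ih hu (diracLower_mem_gaussSpan (diracRaise_mem_gaussSpan hu')), h1, ← inner_diracRaise,
        hR, hR, map_smul, map_smul, inner_smul_left, inner_smul_right, Complex.conj_I, ← mul_assoc,
        neg_mul, hII, neg_neg, one_mul]
    -- Different degrees are orthogonal, and each diagonal term is multiplied by `|c_k|² = 1`.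
    have hker : ⟪toL2 m (Cl m) (T w), toL2 m (Cl m) (T w')⟫_ℂ =
        ⟪toL2 m (Cl m) w, toL2 m (Cl m) w'⟫_ℂ := by
      obtain ⟨N₁, M, hM⟩ := exists_sum_psiZero_eq hm hwm hw
      obtain ⟨N₂, M', hM'⟩ := exists_sum_psiZero_eq hm hwm' hw'
      rw [hM _ (le_max_left N₁ N₂), hM' _ (le_max_right N₁ N₂)]
      simp only [map_sum, hc, sum_inner, inner_sum, map_smul, inner_smul_left, inner_smul_right,
        Finset.mul_sum]
      refine Finset.sum_congr rfl fun k _ => Finset.sum_congr rfl fun l _ => ?_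
      by_cases hkl : l = k
      · subst hkl
        by_cases h0 : psiZero hm l (M l) = 0
        · simp [h0]
        · rw [← mul_assoc, Complex.mul_conj, Complex.normSq_eq_norm_sq,
            hc1 l _ h0]
          simp
      · simp [inner_psiZero hm hkl]
    have hf' : f = diracRaise m u + w := by rw [hwdef]; abel
    have hg' : g = diracRaise m u' + w' := by rw [hwdef']; abel
    have swap : ∀ a b : 𝓢(E m, Cl m), ⟪toL2 m (Cl m) a, toL2 m (Cl m) b⟫_ℂ = 0 →
        ⟪toL2 m (Cl m) b, toL2 m (Cl m) a⟫_ℂ = 0 := fun a b h => inner_eq_zero_symm.mp h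
    rw [hf', hg']
    simp only [map_add, inner_add_left, inner_add_right, hraise, hker,
      cross _ _ hw', crossT _ _ hw', swap _ _ (cross u' w hw),
      swap _ _ (crossT u' w hw)]

/-- A continuous operator that is isometric on the products of polynomials and the Gaussian is
contractive for the `L²` norm. -/
theorem norm_map_le_of_forall_gaussSpan (hm : 1 ≤ m) (T : 𝓢(E m, Cl m) →L[ℂ] 𝓢(E m, Cl m))
    (hT : ∀ n, ∀ g ∈ gaussSpan m n, ‖toL2 m (Cl m) (T g)‖ = ‖toL2 m (Cl m) g‖)
    (f : 𝓢(E m, Cl m)) : ‖toL2 m (Cl m) (T f)‖ ≤ ‖toL2 m (Cl m) f‖ := by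
  obtain ⟨N, C, hC, h⟩ := hermiteBounded_norm_continuous hm
    (((toL2 m (Cl m)).comp T).restrictScalars ℝ)
  refine le_of_forall_pos_le_add fun ε hε => ?_
  -- The approximated function is `H^N f`, not `f`: `L²`-closeness after applying `H^N` controls
  -- both `f - g` and `T (f - g)`. These contribute `ε/(C+1)` and `Cε/(C+1)`, which add up to `ε`.
  obtain ⟨n, g', hg', hlt⟩ := exists_gaussSpan_norm_sub_lt ((hermite m (Cl m) ^ N) f)
    (ε := ε / (C + 1)) (by positivity)
  obtain ⟨g, hg, rfl⟩ := exists_hermite_pow_eq hm N hg'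
  rw [← map_sub] at hlt
  have h1 : ‖toL2 m (Cl m) (T (f - g))‖ ≤ C * (ε / (C + 1)) :=
    (h (f - g)).trans (mul_le_mul_of_nonneg_left hlt.le hC)
  have h2 : ‖toL2 m (Cl m) (f - g)‖ ≤ ε / (C + 1) :=
    (norm_hermite_pow_mono hm (Nat.zero_le N) (f - g)).trans hlt.le
  have h3 : ‖toL2 m (Cl m) g‖ ≤ ‖toL2 m (Cl m) f‖ + ‖toL2 m (Cl m) (f - g)‖ := by
    have := norm_sub_le (toL2 m (Cl m) f) (toL2 m (Cl m) (f - g))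
    simpa using this
  have h4 : ‖toL2 m (Cl m) (T f)‖ ≤ ‖toL2 m (Cl m) (T g)‖ + ‖toL2 m (Cl m) (T (f - g))‖ := by
    have := norm_add_le (toL2 m (Cl m) (T g)) (toL2 m (Cl m) (T (f - g)))
    simpa using this
  rw [hT n g hg] at h4
  have h5 : C * (ε / (C + 1)) + ε / (C + 1) = ε := by field_simp
  linarith

end Isometry

end CliffordFourier
end

/-! ### The uncertainty inequality -/

open CliffordFourier
open scoped SchwartzMap
theorem theorem3p3 {m : ℕ} (hm : 1 ≤ m)
    {ι : ℕ → Type*} (M : ∀ k, Module.Basis (ι k) ℂ (sphericalMonogenics m k))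
    (T : 𝓢(E m, Cl m) →L[ℂ] 𝓢(E m, Cl m))
    (K : E m → E m → Cl m)
    (hK : ∀ (f : 𝓢(E m, Cl m)) (y : E m),
      MeasureTheory.Integrable (fun x => K x y * f x) ∧ T f y = ∫ x, K x y * f x)
    (hI₁ : ∀ f : 𝓢(E m, Cl m), T (dirac m f) = -Complex.I • mulX m (T f))
    (hI₂ : ∀ f : 𝓢(E m, Cl m), T (mulX m f) = -Complex.I • dirac m (T f))
    (μ : ℕ → ℕ → ℂ)
    (hII : ∀ (j k : ℕ) (l : ι k), T (psi j k (M k l)) = μ j k • psi j k (M k l))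
    (hIII : ∀ f : 𝓢(E m, Cl m), T (T (T (T f))) = f)
    (f : 𝓢(E m, Cl m)) :
    normL2 (mulX m f) * normL2 (mulX m (T f)) ≥ (m : ℝ) / 2 * normL2 f ^ 2 := by
  -- The eigenvalue depends on `k` but not on the basis element, so linearity extends it to all of
  -- `𝓜ₖ`. Only `j = 0` is needed; the raising operator generates the rest.
  have hc : ∀ k N, T (psiZero hm k N) = μ 0 k • psiZero hm k N := fun k N =>
    LinearMap.congr_fun ((M k).ext (f₁ := T.toLinearMap ∘ₗ psiZero hm k)
      (f₂ := μ 0 k • psiZero hm k) fun l => hII 0 k l) N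
  -- Nonvanishing is required: if `𝓜ₖ = 0`, nothing constrains the scalar.
  have hc1 : ∀ k (N : sphericalMonogenics m k), psiZero hm k N ≠ 0 → ‖μ 0 k‖ = 1 := by
    intro k N hN
    have h := hIII (psiZero hm k N)
    simp only [hc, map_smul, smul_smul] at h
    have h1 : μ 0 k ^ 4 = 1 := by
      refine smul_left_injective ℂ hN ?_
      simp only [one_smul]
      rw [← h]
      congr 1
      ring
    exact Complex.norm_eq_one_of_pow_eq_one h1 (by norm_num)
  have hT := norm_map_le_of_forall_gaussSpan hm T fun n g hg => by
    have := inner_map_map_of_mem_gaussSpan hm T hI₁ hI₂ (μ 0) hc hc1 hg hg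
    rw [norm_eq_sqrt_re_inner (𝕜 := ℂ), norm_eq_sqrt_re_inner (𝕜 := ℂ), this]
  -- Three applications of the contraction bound to `T ∂f`, with `T⁴ = id`, give the reverse
  -- inequality.
  have hdirac : ‖toL2 m (Cl m) (dirac m f)‖ ≤ ‖toL2 m (Cl m) (mulX m (T f))‖ := by
    have h := hI₁ f
    calc _ = ‖toL2 m (Cl m) (T (T (T (T (dirac m f)))))‖ := by rw [hIII]
      _ ≤ ‖toL2 m (Cl m) (T (dirac m f))‖ := (hT _).trans ((hT _).trans (hT _))
      _ = _ := by rw [h, map_smul, norm_smul]; simp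
  simp only [normL2_eq, ge_iff_le]
  exact (heisenberg_dirac f).trans (mul_le_mul_of_nonneg_left hdirac (norm_nonneg _))
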